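/- Setup. Let $V$ be a complex superspace of dimension $d=N+2m$ with $\dim V_{\bar 0}=N$, $\dim V_{\bar 1}=2m$ and a homogeneous basis $v_1,\dots,v_d$ such that, with $i'=d+1-i$ and $\overline{i}=|v_i|$, one has $\overline{i}=\overline{i'}$ for all $i$. Put $r=\lfloor d/2\rfloor$, $\Upsilon_V=(\overline{1},\dots,\overline{r})$, $\kappa=\frac N2-m-1$, and $\theta_i=1$, $\theta_{i'}=(-1)^{\overline{i}}$ for $1\le i\le\lceil d/2\rceil$. Let $$R(u)=\mathrm I-\frac{P}{u}+\frac{Q}{u-\kappa},\qquad P=\sum_{i,j}(-1)^{\overline{j}}e_{ij}\otimes e_{ji},\qquad Q=\sum_{i,j}(-1)^{\overline{i}\,\overline{j}}\theta_i\theta_j\,e_{ij}\otimes e_{i'j'} .$$ The extended Yangian $X^{\mathrm{rtt}}(\mathfrak{osp}(V))$ is the associative $\mathbb C$-superalgebra generated by $t_{ij}^{(s)}$ ($1\le i,j\le d$, $s\ge1$), of parity $\overline{i}+\overline{j}$, subject to $$R(u-v)T_1(u)T_2(v)=T_2(v)T_1(u)R(u-v)$$ in the graded tensor product $\mathrm{End}\,V\otimes\mathrm{End}\,V\otimes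 X^{\mathrm{rtt}}(\mathfrak{osp}(V))$ (with formal series coefficients), where $T(u)=\sum_{i,j}(-1)^{\overline{i}\,\overline{j}+\overline{j}}e_{ij}\otimes t_{ij}(u)$, $t_{ij}(u)=\delta_{ij}+\sum_{s\ge1}t_{ij}^{(s)}u^{-s}$, and $T_1$, $T_2$ have the $\mathrm{End}\,V$-component of $T$ in the first, respectively second, factor. Consider the Gauss decomposition of the matrix $(t_{ij}(u))=F(u)H(u)E(u)$, with $H(u)$ diagonal and $F(u)=(f_{ij}(u))$, $E(u)=(e_{ij}(u))$ lower, respectively upper, unitriangular. Put $e_i(u)=e_{i,i+1}(u)$ and $f_i(u)=f_{i+1,i}(u)$ for $1\le i\le r$, except that $e_r(u)=e_{r-1,r+1}(u)$ and $f_r(u)=f_{r+1,r-1}(u)$ if $N$ is even and $\overline{r}=\bar 0$. Let $e_i^{(1)}$, $f_i^{(1)}$ be the coefficients of $u^{-1}$ in $e_i(u)$, $f_i(u)$. Below, $[\cdot,\cdot]$ is the supercommutator, $[x,y]=xy-(-1)^{|x||y|}yx$ for homogeneous $x,y$, and $\ast$ stands for an arbitrary parity. Statement. The following relations hold in $X^{\mathrm{rtt}}(\mathfrak{osp}(V))$.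 1. (Degree 3.) If $\dim V=6$ and $\Upsilon_V=(\ast,\bar 1,\bar 0)$, then $$\big[e_3^{(1)},[e_2^{(1)},e_1(u)]\big]-\big[e_2^{(1)},[e_3^{(1)},e_1(u)]\big]=0,\qquad \big[f_3^{(1)},[f_2^{(1)},f_1(u)]\big]-\big[f_2^{(1)},[f_3^{(1)},f_1(u)]\big]=0 .$$ 2. (Degree 4.) If $\dim V=7$ and $\Upsilon_V=(\overline 1,\overline 2,\overline 3)$ with $\overline 2\ne\overline 3$, then $$\big[[e_1(u),e_2^{(1)}],[e_2^{(1)},e_3^{(1)}]\big]=0,\qquad \big[[f_1(u),f_2^{(1)}],[f_2^{(1)},f_3^{(1)}]\big]=0 .$$ 3. (Degree 7.) If $\dim V=8$ and $\Upsilon_V=(\ast,\bar 0,\bar 0,\bar 1)$, then $$\Big[\big[e_1(u),[e_2^{(1)},e_3^{(1)}]\big],\big[[e_2^{(1)},e_3^{(1)}],[e_3^{(1)},e_4^{(1)}]\big]\Big]=0,\qquad \Big[\big[f_1(u),[f_2^{(1)},f_3^{(1)}]\big],\big[[f_2^{(1)},f_3^{(1)}],[f_3^{(1)},f_4^{(1)}]\big]\Big]=0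 .$$ In particular (taking the coefficients of $u^{-1}$), in each of the three cases the same relations hold with $e_1(u),f_1(u)$ replaced by $e_1^{(1)},f_1^{(1)}$; that is, the elements $e_i^{(1)}$ and the elements $f_i^{(1)}$ satisfy the corresponding higher order Serre relations of the Lie superalgebra $\mathfrak{osp}(V)$. -/

import Mathlib

open PowerSeries

noncomputable section

/-! ## Superalgebras and the supercommutator -/

/-- A superalgebra over `ℂ`: an associative algebra with a `ℤ/2`-grading. The grading is given by
its parity involution `x ↦ (-1)^{|x|} x`, whose `±1`-eigenspaces are the even and odd parts. -/
class Superalgebra (B : Type*) [Ring B] [Algebra ℂ B] where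
  parityAut : B →ₐ[ℂ] B
  parityAut_parityAut : ∀ x, parityAut (parityAut x) = x

/-- The sign `(-1)^a` of `a ∈ ℤ/2`. -/
def superSign (a : ZMod 2) : ℂ := if a = 0 then 1 else -1

namespace Superalgebra

variable {B : Type*} [Ring B] [Algebra ℂ B] [Superalgebra B]

/-- `x` is homogeneous of parity `a`. -/
def IsHomogeneous (a : ZMod 2) (x : B) : Prop := parityAut x = superSign a • x

def evenPart (x : B) : B := (1 / 2 : ℂ) • (x + parityAut x)

def oddPart (x : B) : B := (1 / 2 : ℂ) • (x - parityAut x)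

/-- The supercommutator: the bilinear operation with `[x, y] = xy - (-1)^{|x||y|} yx` for
homogeneous `x` and `y` (see `bracket_of_isHomogeneous`). -/
def bracket (x y : B) : B := x * y - y * evenPart x - parityAut y * oddPart x

theorem bracket_of_isHomogeneous {a b : ZMod 2} {x y : B}
    (hx : IsHomogeneous a x) (hy : IsHomogeneous b y) :
    bracket x y = x * y - superSign (a * b) • (y * x) := by
  have h2 : ∀ z : B, (1 / 2 : ℂ) • (z + z) = z := fun z => by
    rw [← two_smul ℂ z, smul_smul]; norm_num
  have hz : ∀ c : ZMod 2, c = 0 ∨ c = 1 := by decide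
  have ha := hz a
  have hb := hz b
  unfold IsHomogeneous at hx hy
  unfold bracket evenPart oddPart
  rw [hx, hy]
  obtain rfl | rfl := ha <;> obtain rfl | rfl := hb <;>
    simp only [superSign, mul_zero, mul_one, if_true, one_ne_zero, if_false, one_smul,
      neg_smul, sub_self, smul_zero, sub_zero, add_neg_cancel, sub_neg_eq_add, neg_mul, h2]

/-- Power series in an even central variable over a superalgebra form a superalgebra. -/
instance : Superalgebra B⟦X⟧ where
  parityAut := PowerSeries.mapAlgHom parityAut
  parityAut_parityAut x := by
    ext n
    simp [PowerSeries.mapAlgHom_apply, parityAut_parityAut]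

end Superalgebra

notation "⁅" x ", " y "⁆ₛ" => Superalgebra.bracket x y

/-! ## The Gauss decomposition -/

/-- `gaussStep T k` is the matrix `T` after `k` steps of Gaussian elimination (of interest only in
the rows and columns with indices `≥ k`). The pivots have constant term `1` when `T` is congruent to
the identity modulo the variable, and `invOfUnit _ 1` is then the inverse. -/
def gaussStep {B : Type*} [Ring B] {d : ℕ} (T : Matrix (Fin d) (Fin d) B⟦X⟧) :
    ℕ → Matrix (Fin d) (Fin d) B⟦X⟧
  | 0 => T
  | k + 1 => fun i j =>
      if h : k < d then
        gaussStep T k i j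
          - gaussStep T k i ⟨k, h⟩ * invOfUnit (gaussStep T k ⟨k, h⟩ ⟨k, h⟩) 1
            * gaussStep T k ⟨k, h⟩ j
      else gaussStep T k i j

/-- The diagonal entries of `H` in the Gauss decomposition `T = F H E`. -/
def gaussH {B : Type*} [Ring B] {d : ℕ} (T : Matrix (Fin d) (Fin d) B⟦X⟧) (i : Fin d) : B⟦X⟧ :=
  gaussStep T i i i

/-- The upper unitriangular factor `E` in the Gauss decomposition `T = F H E`. -/
def gaussE {B : Type*} [Ring B] {d : ℕ} (T : Matrix (Fin d) (Fin d) B⟦X⟧) :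
    Matrix (Fin d) (Fin d) B⟦X⟧ := fun i j =>
  if i < j then invOfUnit (gaussH T i) 1 * gaussStep T i i j else if i = j then 1 else 0

/-- The lower unitriangular factor `F` in the Gauss decomposition `T = F H E`. -/
def gaussF {B : Type*} [Ring B] {d : ℕ} (T : Matrix (Fin d) (Fin d) B⟦X⟧) :
    Matrix (Fin d) (Fin d) B⟦X⟧ := fun j i =>
  if i < j then gaussStep T i j i * invOfUnit (gaussH T i) 1 else if i = j then 1 else 0

theorem constantCoeff_gaussStep {B : Type*} [Ring B] {d : ℕ} (T : Matrix (Fin d) (Fin d) B⟦X⟧)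
    (hT : ∀ i j, constantCoeff (T i j) = if i = j then 1 else 0) (k : ℕ) (i j : Fin d)
    (hi : k ≤ i) (hj : k ≤ j) :
    constantCoeff (gaussStep T k i j) = if i = j then 1 else 0 := by
  induction k generalizing i j with
  | zero => exact hT i j
  | succ k ih =>
    have hk : k < d := by omega
    have hne : (⟨k, hk⟩ : Fin d) ≠ j := by
      intro h; rw [← h] at hj; simp at hj
    simp only [gaussStep, dif_pos hk, map_sub, map_mul]
    rw [ih i j (by omega) (by omega), ih ⟨k, hk⟩ j (le_refl _) (by omega), if_neg hne]
    simp

theorem gaussH_mul_inv {B : Type*} [Ring B] {d : ℕ} (T : Matrix (Fin d) (Fin d) B⟦X⟧)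
    (hT : ∀ i j, constantCoeff (T i j) = if i = j then 1 else 0) (i : Fin d) :
    gaussH T i * invOfUnit (gaussH T i) 1 = 1 ∧ invOfUnit (gaussH T i) 1 * gaussH T i = 1 := by
  have h : constantCoeff (gaussH T i) = ((1 : Bˣ) : B) := by
    simpa [gaussH] using constantCoeff_gaussStep T hT i i i le_rfl le_rfl
  exact ⟨mul_invOfUnit _ _ h, invOfUnit_mul _ _ h⟩

/-- The matrices above do give the Gauss decomposition `T = F H E`. -/
theorem gauss_decomposition {B : Type*} [Ring B] {d : ℕ} (T : Matrix (Fin d) (Fin d) B⟦X⟧)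
    (hT : ∀ i j, constantCoeff (T i j) = if i = j then 1 else 0) :
    T = gaussF T * Matrix.diagonal (gaussH T) * gaussE T := by
  have key : ∀ k : ℕ, ∀ i j : Fin d, k ≤ i → k ≤ j →
      T i j = gaussStep T k i j
        + ∑ p : Fin d, if (p : ℕ) < k then gaussF T i p * gaussH T p * gaussE T p j else 0 := by
    intro k
    induction k with
    | zero => intro i j _ _; simp [gaussStep]
    | succ k ih =>
      intro i j hi hj
      have hk : k < d := by omega
      have hki : (⟨k, hk⟩ : Fin d) < i := by rw [Fin.lt_def]; simp; omega
      have hkj : (⟨k, hk⟩ : Fin d) < j := by rw [Fin.lt_def]; simp; omega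
      have hsum : (∑ p : Fin d,
          if (p : ℕ) < k + 1 then gaussF T i p * gaussH T p * gaussE T p j else 0)
          = (∑ p : Fin d, if (p : ℕ) < k then gaussF T i p * gaussH T p * gaussE T p j else 0)
            + gaussF T i ⟨k, hk⟩ * gaussH T ⟨k, hk⟩ * gaussE T ⟨k, hk⟩ j := by
        have hs : gaussF T i ⟨k, hk⟩ * gaussH T ⟨k, hk⟩ * gaussE T ⟨k, hk⟩ j
            = ∑ p : Fin d, if p = ⟨k, hk⟩ then gaussF T i p * gaussH T p * gaussE T p j else 0 := by
          simp
        rw [hs, ← Finset.sum_add_distrib]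
        refine Finset.sum_congr rfl fun p _ => ?_
        by_cases h1 : (p : ℕ) < k
        · have : p ≠ ⟨k, hk⟩ := by rintro rfl; simp at h1
          simp [h1, this, Nat.lt_succ_of_lt h1]
        · by_cases h2 : p = ⟨k, hk⟩
          · subst h2; simp
          · have h3 : ¬ (p : ℕ) < k + 1 := by
              intro h; apply h2; ext; simp; omega
            simp [h1, h2, h3]
      rw [hsum, ih i j (by omega) (by omega)]
      have hstep : gaussStep T (k + 1) i j = gaussStep T k i j
          - gaussStep T k i ⟨k, hk⟩ * invOfUnit (gaussH T ⟨k, hk⟩) 1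
            * gaussStep T k ⟨k, hk⟩ j := by
        simp [gaussStep, hk, gaussH]
      have hfe : gaussF T i ⟨k, hk⟩ * gaussH T ⟨k, hk⟩ * gaussE T ⟨k, hk⟩ j
          = gaussStep T k i ⟨k, hk⟩ * invOfUnit (gaussH T ⟨k, hk⟩) 1
            * gaussStep T k ⟨k, hk⟩ j := by
        simp only [gaussF, gaussE, hki, hkj, if_true]
        rw [mul_assoc (gaussStep T k i ⟨k, hk⟩), (gaussH_mul_inv T hT ⟨k, hk⟩).2, mul_one,
          mul_assoc]
      rw [hstep, hfe]; abel
  funext i j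
  rw [Matrix.mul_apply]
  simp only [Matrix.mul_diagonal]
  obtain hij | hij := le_total i j
  · rw [key i i j le_rfl hij]
    have h1 : gaussStep T i i j = gaussF T i i * gaussH T i * gaussE T i j := by
      obtain h | h := hij.lt_or_eq
      · simp only [gaussF, gaussE, h, lt_irrefl, if_true, if_false, one_mul]
        rw [← mul_assoc, (gaussH_mul_inv T hT i).1, one_mul]
      · subst h; simp [gaussF, gaussE, gaussH]
    have hs : gaussF T i i * gaussH T i * gaussE T i j
        = ∑ p : Fin d, if p = i then gaussF T i p * gaussH T p * gaussE T p j else 0 := by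
      simp
    rw [h1, hs, ← Finset.sum_add_distrib]
    refine Finset.sum_congr rfl fun p _ => ?_
    obtain h | h | h := lt_trichotomy p i
    · simp [h, h.ne]
    · subst h; simp
    · have : gaussF T i p = 0 := by simp [gaussF, h.not_gt, h.ne']
      simp [this]
  · rw [key j i j hij le_rfl]
    have h1 : gaussStep T j i j = gaussF T i j * gaussH T j * gaussE T j j := by
      obtain h | h := hij.lt_or_eq
      · simp only [gaussF, gaussE, h, lt_irrefl, if_true, if_false, mul_one]
        rw [mul_assoc, (gaussH_mul_inv T hT j).2, mul_one]
      · subst h; simp [gaussF, gaussE, gaussH]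
    have hs : gaussF T i j * gaussH T j * gaussE T j j
        = ∑ p : Fin d, if p = j then gaussF T i p * gaussH T p * gaussE T p j else 0 := by
      simp
    rw [h1, hs, ← Finset.sum_add_distrib]
    refine Finset.sum_congr rfl fun p _ => ?_
    obtain h | h | h := lt_trichotomy p j
    · simp [h, h.ne]
    · subst h; simp
    · have : gaussE T p j = 0 := by simp [gaussE, h.not_gt, h.ne']
      simp [this]

/-! ## The superspace `V` and the RTT relation -/

/-- A superspace `V` of dimension `d = N + 2m` with homogeneous basis `v_i`, such that `v_i` and
`v_{i'}` have the same parity, where `i'` is the reflected index `Fin.rev i`, and the odd part has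
even dimension. Indices are 0-based: the basis usually
written `v_1, …, v_d` is `v_0, …, v_{d-1}` here. -/
structure OspSpace (d : ℕ) where
  parity : Fin d → ZMod 2
  parity_rev : ∀ i, parity i.rev = parity i
  even_card_odd : Even (Finset.univ.filter fun i => parity i = 1).card

namespace OspSpace

variable {d : ℕ} (V : OspSpace d)

/-- The parity sequence `(|v_1|, …, |v_r|)` (1-based), where `r = ⌊N/2⌋ + m = ⌊d/2⌋`. -/
def paritySeq (i : Fin (d / 2)) : ZMod 2 :=
  V.parity (i.castLE (Nat.div_le_self d 2))

/-- `κ = N/2 - m - 1`, where `N = dim V_0` and `2m = dim V_1`. -/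
def kappa : ℂ :=
  ((Finset.univ.filter fun i => V.parity i = 0).card : ℂ) / 2
    - ((Finset.univ.filter fun i => V.parity i = 1).card : ℂ) / 2 - 1

/-- `θ_i = 1` for `i` in the first half (rounded up) and `θ_{i'} = (-1)^{|v_i|}`. -/
def theta (i : Fin d) : ℂ := if (i : ℕ) < (d + 1) / 2 then 1 else superSign (V.parity i)

/-- Elements of the graded tensor product `End V ⊗ End V ⊗ B`: the entry `M i j k l ∈ B` is the
coefficient of `e_{ij} ⊗ e_{kl}`. -/
abbrev Tensor2 (_ : OspSpace d) (B : Type*) : Type _ := Fin d → Fin d → Fin d → Fin d → B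

/-- The product of the graded tensor product `End V ⊗ End V ⊗ B` of superalgebras, i.e.
`(x ⊗ y ⊗ b)(x' ⊗ y' ⊗ b') = (-1)^{|y||x'| + |b|(|x'| + |y'|)} xx' ⊗ yy' ⊗ bb'`, where `e_{ij}` has
parity `|v_i| + |v_j|`. The sign `(-1)^{|b|}` is applied through the parity involution. -/
def tmul {B : Type*} [Ring B] [Algebra ℂ B] [Superalgebra B] (M M' : V.Tensor2 B) : V.Tensor2 B :=
  fun i j k l => ∑ a, ∑ c,
    superSign ((V.parity k + V.parity c) * (V.parity a + V.parity j)) •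
      ((if (V.parity a + V.parity j) + (V.parity c + V.parity l) = 0 then M i a k c
        else Superalgebra.parityAut (M i a k c)) * M' a j c l)

/-- The identity `I`, as an operator on `V ⊗ V`. -/
def opI : V.Tensor2 ℂ := fun i j k l => if i = j ∧ k = l then 1 else 0

/-- `P = ∑ (-1)^{|v_j|} e_{ij} ⊗ e_{ji}`. -/
def opP : V.Tensor2 ℂ := fun i j k l => if k = j ∧ l = i then superSign (V.parity j) else 0

/-- `Q = ∑ (-1)^{|v_i||v_j|} θ_i θ_j e_{ij} ⊗ e_{i'j'}`. -/
def opQ : V.Tensor2 ℂ := fun i j k l =>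
  if k = i.rev ∧ l = j.rev then superSign (V.parity i * V.parity j) * V.theta i * V.theta j else 0

/-- The generators `t_{ij}^{(r)}`, `r ≥ 1`; the triple `⟨i, j, r⟩` stands for `t_{ij}^{(r+1)}`. -/
structure Gen (V : OspSpace d) where
  row : Fin d
  col : Fin d
  idx : ℕ

/-- The free superalgebra on the `t_{ij}^{(r)}`, `r ≥ 1`. -/
abbrev Free : Type := FreeAlgebra ℂ V.Gen

/-- `|t_{ij}^{(r)}| = |v_i| + |v_j|`. -/
instance : Superalgebra V.Free where
  parityAut := FreeAlgebra.lift ℂ fun g =>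
    superSign (V.parity g.row + V.parity g.col) • FreeAlgebra.ι ℂ g
  parityAut_parityAut x := by
    rw [← AlgHom.comp_apply]
    conv_rhs => rw [← AlgHom.id_apply (R := ℂ) x]
    congr 1
    ext g
    simp only [AlgHom.comp_apply, Function.comp_apply, FreeAlgebra.lift_ι_apply, map_smul,
      smul_smul, AlgHom.id_apply]
    have : superSign (V.parity g.row + V.parity g.col) * superSign (V.parity g.row + V.parity g.col)
        = 1 := by unfold superSign; split_ifs <;> norm_num
    rw [this, one_smul]

/-- The series `t_{ij}(u) = δ_{ij} + ∑_{r ≥ 1} t_{ij}^{(r)} u^{-r}` over the free superalgebra, as a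
power series in `u^{-1}`. -/
def freeT (i j : Fin d) : V.Free⟦X⟧ :=
  PowerSeries.mk fun r => match r with
    | 0 => if i = j then 1 else 0
    | r + 1 => FreeAlgebra.ι ℂ (⟨i, j, r⟩ : V.Gen)

/-- The variable `x = u^{-1}` of the ring of power series in `u^{-1}` and `v^{-1}`, realized as
power series in `v^{-1}` over power series in `u^{-1}`. -/
def invU : V.Free⟦X⟧⟦X⟧ := PowerSeries.C PowerSeries.X

/-- The variable `y = v^{-1}`. -/
def invV : V.Free⟦X⟧⟦X⟧ := PowerSeries.X

/-- `T_1(u) = ∑ (-1)^{|v_i||v_j| + |v_j|} e_{ij} ⊗ 1 ⊗ t_{ij}(u)`. -/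
def T1 : V.Tensor2 V.Free⟦X⟧⟦X⟧ := fun i j k l =>
  if k = l then superSign (V.parity i * V.parity j + V.parity j) • PowerSeries.C (V.freeT i j)
  else 0

/-- `T_2(v) = ∑ (-1)^{|v_k||v_l| + |v_l|} 1 ⊗ e_{kl} ⊗ t_{kl}(v)`. -/
def T2 : V.Tensor2 V.Free⟦X⟧⟦X⟧ := fun i j k l =>
  if i = j then superSign (V.parity k * V.parity l + V.parity l) •
    PowerSeries.map PowerSeries.C (V.freeT k l)
  else 0

/-- The `R`-matrix `R(u-v) = I - P/(u-v) + Q/(u-v-κ)` with its denominators cleared, namely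
`u^{-2} v^{-2} (u-v)(u-v-κ) R(u-v)`. With `x = u^{-1}` and `y = v^{-1}` one has `xy(u-v) = y - x`
and `xy(u-v-κ) = y - x - κxy`. -/
def clearedR : V.Tensor2 V.Free⟦X⟧⟦X⟧ := fun i j k l =>
  let x := V.invU
  let y := V.invV
  V.opI i j k l • ((y - x) * (y - x - V.kappa • (x * y)))
    - V.opP i j k l • (x * y * (y - x - V.kappa • (x * y)))
    + V.opQ i j k l • (x * y * (y - x))

/-- `R(u-v) T_1(u) T_2(v)`, with denominators cleared. -/
def rttLHS : V.Tensor2 V.Free⟦X⟧⟦X⟧ := V.tmul (V.tmul V.clearedR V.T1) V.T2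

/-- `T_2(v) T_1(u) R(u-v)`, with denominators cleared. -/
def rttRHS : V.Tensor2 V.Free⟦X⟧⟦X⟧ := V.tmul (V.tmul V.T2 V.T1) V.clearedR

/-- The defining relations: all coefficients of the RTT relation
`R(u-v) T_1(u) T_2(v) = T_2(v) T_1(u) R(u-v)`. -/
inductive RTTRel : V.Free → V.Free → Prop
  | rtt (i j k l : Fin d) (r s : ℕ) :
      RTTRel (PowerSeries.coeff r (PowerSeries.coeff s (V.rttLHS i j k l)))
        (PowerSeries.coeff r (PowerSeries.coeff s (V.rttRHS i j k l)))

/-- The RTT extended Yangian `X^rtt(osp(V))`. -/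
abbrev XRTT : Type := RingQuot V.RTTRel

/-! ### The superalgebra structure of `X^rtt(osp(V))` -/

/-- `M` is an even element of `End V ⊗ End V ⊗ B`. -/
def IsEvenTensor {B : Type*} [Ring B] [Algebra ℂ B] [Superalgebra B] (M : V.Tensor2 B) : Prop :=
  ∀ i j k l, Superalgebra.parityAut (M i j k l)
    = superSign (V.parity i + V.parity j + V.parity k + V.parity l) • M i j k l

theorem superSign_add (a b : ZMod 2) : superSign (a + b) = superSign a * superSign b := by
  have ha : a = 0 ∨ a = 1 := by revert a; decide
  have hb : b = 0 ∨ b = 1 := by revert b; decide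
  have h2 : (1 + 1 : ZMod 2) = 0 := by decide
  obtain rfl | rfl := ha <;> obtain rfl | rfl := hb <;> simp [superSign, h2]

theorem superSign_mul_self (a : ZMod 2) : superSign a * superSign a = 1 := by
  unfold superSign; split_ifs <;> norm_num

theorem IsEvenTensor.tmul {B : Type*} [Ring B] [Algebra ℂ B] [Superalgebra B]
    {M M' : V.Tensor2 B} (h : V.IsEvenTensor M) (h' : V.IsEvenTensor M') :
    V.IsEvenTensor (V.tmul M M') := by
  intro i j k l
  unfold OspSpace.tmul
  simp only [map_sum, map_smul, map_mul, Finset.smul_sum]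
  refine Finset.sum_congr rfl fun a _ => Finset.sum_congr rfl fun c _ => ?_
  rw [h' a j c l, smul_comm]
  congr 1
  have hs : superSign (V.parity i + V.parity a + V.parity k + V.parity c) *
      superSign (V.parity a + V.parity j + V.parity c + V.parity l)
      = superSign (V.parity i + V.parity j + V.parity k + V.parity l) := by
    simp only [superSign_add]
    linear_combination (superSign (V.parity i) * superSign (V.parity j) * superSign (V.parity k) *
      superSign (V.parity l)) * (superSign_mul_self (V.parity a)) *
        (superSign (V.parity c) * superSign (V.parity c)) +
      (superSign (V.parity i) * superSign (V.parity j) * superSign (V.parity k) *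
      superSign (V.parity l)) * (superSign_mul_self (V.parity c))
  rw [← hs]
  split_ifs
  · rw [h i a k c, smul_mul_smul_comm]
  · rw [h i a k c, map_smul, h i a k c, smul_mul_smul_comm, smul_mul_assoc]

theorem parityAut_freeT (i j : Fin d) :
    Superalgebra.parityAut (V.freeT i j) = superSign (V.parity i + V.parity j) • V.freeT i j := by
  ext r
  change PowerSeries.coeff r (PowerSeries.mapAlgHom Superalgebra.parityAut (V.freeT i j)) = _
  rw [PowerSeries.mapAlgHom_apply, PowerSeries.coeff_map, PowerSeries.coeff_smul]
  unfold freeT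
  rw [PowerSeries.coeff_mk]
  cases r with
  | zero =>
    by_cases h : i = j
    · subst h
      have : V.parity i + V.parity i = 0 := CharTwo.add_self_eq_zero _
      simp [this, superSign]
    · simp [h]
  | succ r =>
    change FreeAlgebra.lift ℂ _ (FreeAlgebra.ι ℂ (⟨i, j, r⟩ : V.Gen)) = _
    rw [FreeAlgebra.lift_ι_apply]

theorem isEvenTensor_T1 : V.IsEvenTensor V.T1 := by
  intro i j k l
  unfold T1
  split_ifs with h
  · subst h
    have h0 : V.parity i + V.parity j + V.parity k + V.parity k = V.parity i + V.parity j := by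
      rw [add_assoc, CharTwo.add_self_eq_zero, add_zero]
    rw [h0, map_smul, smul_comm]
    congr 1
    change PowerSeries.mapAlgHom Superalgebra.parityAut (PowerSeries.C (V.freeT i j)) = _
    rw [PowerSeries.mapAlgHom_apply, PowerSeries.map_C]
    change PowerSeries.C (Superalgebra.parityAut (V.freeT i j)) = _
    rw [parityAut_freeT]
    ext n
    simp only [PowerSeries.coeff_C, PowerSeries.coeff_smul]
    split_ifs <;> simp
  · simp

theorem isEvenTensor_T2 : V.IsEvenTensor V.T2 := by
  intro i j k l
  unfold T2
  split_ifs with h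
  · subst h
    have h0 : V.parity i + V.parity i + V.parity k + V.parity l = V.parity k + V.parity l := by
      rw [CharTwo.add_self_eq_zero, zero_add]
    rw [h0, map_smul, smul_comm]
    congr 1
    have h1 := V.parityAut_freeT k l
    change PowerSeries.mapAlgHom Superalgebra.parityAut (V.freeT k l) = _ at h1
    rw [PowerSeries.mapAlgHom_apply] at h1
    change PowerSeries.mapAlgHom (PowerSeries.mapAlgHom Superalgebra.parityAut) _ = _
    rw [PowerSeries.mapAlgHom_apply]
    ext n m
    have h2 := congrArg (PowerSeries.coeff n) h1
    rw [PowerSeries.coeff_map, PowerSeries.coeff_smul] at h2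
    simp only [PowerSeries.coeff_map, PowerSeries.coeff_smul, PowerSeries.coeff_C,
      RingHom.coe_coe, PowerSeries.mapAlgHom_apply]
    split_ifs
    · exact h2
    · simp
  · simp

theorem parityAut_invU : Superalgebra.parityAut V.invU = V.invU := by
  change PowerSeries.mapAlgHom (PowerSeries.mapAlgHom Superalgebra.parityAut) _ = _
  unfold invU
  rw [PowerSeries.mapAlgHom_apply, PowerSeries.map_C]
  congr 1
  change PowerSeries.mapAlgHom Superalgebra.parityAut _ = _
  rw [PowerSeries.mapAlgHom_apply, PowerSeries.map_X]

theorem parityAut_invV : Superalgebra.parityAut V.invV = V.invV := by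
  change PowerSeries.mapAlgHom (PowerSeries.mapAlgHom Superalgebra.parityAut) _ = _
  unfold invV
  rw [PowerSeries.mapAlgHom_apply, PowerSeries.map_X]

theorem isEvenTensor_clearedR : V.IsEvenTensor V.clearedR := by
  intro i j k l
  unfold clearedR
  simp only [map_add, map_sub, map_smul, map_mul, parityAut_invU, parityAut_invV]
  by_cases h : V.parity i + V.parity j + V.parity k + V.parity l = 0
  · rw [h]; simp [superSign]
  · have hI : V.opI i j k l = 0 := by
      unfold opI; rw [if_neg]; rintro ⟨rfl, rfl⟩
      apply h; rw [add_assoc, CharTwo.add_self_eq_zero, CharTwo.add_self_eq_zero, add_zero]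
    have hP : V.opP i j k l = 0 := by
      unfold opP; rw [if_neg]; rintro ⟨rfl, rfl⟩
      apply h; rw [add_assoc, add_comm (V.parity k), CharTwo.add_self_eq_zero]
    have hQ : V.opQ i j k l = 0 := by
      unfold opQ; rw [if_neg]; rintro ⟨rfl, rfl⟩
      apply h; rw [V.parity_rev, V.parity_rev, add_assoc, CharTwo.add_self_eq_zero]
    simp [hI, hP, hQ]

/-- The grading of the free superalgebra descends to `X^rtt(osp(V))`. -/
def xParityAut : V.XRTT →ₐ[ℂ] V.XRTT :=
  RingQuot.liftAlgHom ℂ ⟨(RingQuot.mkAlgHom ℂ V.RTTRel).comp Superalgebra.parityAut, by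
    rintro _ _ ⟨i, j, k, l, r, s⟩
    have hc : ∀ M : V.Tensor2 V.Free⟦X⟧⟦X⟧, V.IsEvenTensor M →
        Superalgebra.parityAut (PowerSeries.coeff r (PowerSeries.coeff s (M i j k l)))
          = superSign (V.parity i + V.parity j + V.parity k + V.parity l) •
            PowerSeries.coeff r (PowerSeries.coeff s (M i j k l)) := by
      intro M hM
      have h1 := hM i j k l
      change PowerSeries.mapAlgHom (PowerSeries.mapAlgHom Superalgebra.parityAut) _ = _ at h1
      have h2 := congrArg (fun z => PowerSeries.coeff r (PowerSeries.coeff s z)) h1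
      simpa only [PowerSeries.mapAlgHom_apply, PowerSeries.coeff_map, PowerSeries.coeff_smul,
        RingHom.coe_coe] using h2
    have hL : V.IsEvenTensor V.rttLHS :=
      IsEvenTensor.tmul V (IsEvenTensor.tmul V V.isEvenTensor_clearedR V.isEvenTensor_T1)
        V.isEvenTensor_T2
    have hR : V.IsEvenTensor V.rttRHS :=
      IsEvenTensor.tmul V (IsEvenTensor.tmul V V.isEvenTensor_T2 V.isEvenTensor_T1)
        V.isEvenTensor_clearedR
    rw [AlgHom.comp_apply, AlgHom.comp_apply, hc _ hL, hc _ hR, map_smul, map_smul,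
      RingQuot.mkAlgHom_rel ℂ (RTTRel.rtt i j k l r s)]⟩

theorem xParityAut_mk (x : V.Free) :
    V.xParityAut (RingQuot.mkAlgHom ℂ V.RTTRel x)
      = RingQuot.mkAlgHom ℂ V.RTTRel (Superalgebra.parityAut x) := by
  simp [xParityAut]

instance : Superalgebra V.XRTT where
  parityAut := V.xParityAut
  parityAut_parityAut x := by
    obtain ⟨y, rfl⟩ := RingQuot.mkAlgHom_surjective ℂ V.RTTRel x
    rw [xParityAut_mk, xParityAut_mk, Superalgebra.parityAut_parityAut]

/-! ### The currents -/

/-- The matrix `T(u)` with entries `t_{ij}(u) ∈ X^rtt(osp(V))[[u^{-1}]]`. -/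
def T : Matrix (Fin d) (Fin d) V.XRTT⟦X⟧ := fun i j =>
  PowerSeries.map (RingQuot.mkAlgHom ℂ V.RTTRel : V.Free →+* V.XRTT) (V.freeT i j)

theorem constantCoeff_T (i j : Fin d) : constantCoeff (V.T i j) = if i = j then 1 else 0 := by
  rw [← coeff_zero_eq_constantCoeff_apply]
  simp only [T, freeT, PowerSeries.coeff_map, PowerSeries.coeff_mk]
  split_ifs <;> simp

theorem T_gauss : V.T = gaussF V.T * Matrix.diagonal (gaussH V.T) * gaussE V.T :=
  gauss_decomposition V.T V.constantCoeff_T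

/-- The pair of (0-based) matrix positions attached to the `i`-th simple root, `1 ≤ i ≤ r = ⌊d/2⌋`:
with 1-based indices it is `(i, i+1)`, except that it is `(r-1, r+1)` if `i = r`, `d` is
even and `v_r` is even. -/
def simplePos (i : ℕ) (h : 1 ≤ i ∧ i ≤ d / 2) : Fin d × Fin d :=
  if i = d / 2 ∧ Even d ∧ V.parity ⟨i - 1, by omega⟩ = 0 then
    (⟨i - 2, by omega⟩, ⟨i, by omega⟩)
  else (⟨i - 1, by omega⟩, ⟨i, by omega⟩)

/-- The current `e_i(u)`, `1 ≤ i ≤ r` (1-based; zero outside of this range). -/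
def e (i : ℕ) : V.XRTT⟦X⟧ :=
  if h : 1 ≤ i ∧ i ≤ d / 2 then gaussE V.T (V.simplePos i h).1 (V.simplePos i h).2 else 0

/-- The current `f_i(u)`, `1 ≤ i ≤ r` (1-based; zero outside of this range). -/
def f (i : ℕ) : V.XRTT⟦X⟧ :=
  if h : 1 ≤ i ∧ i ≤ d / 2 then gaussF V.T (V.simplePos i h).2 (V.simplePos i h).1 else 0

/-- The coefficient `e_i^{(1)}` of `u^{-1}` in `e_i(u)`. -/
def e₁ (i : ℕ) : V.XRTT := PowerSeries.coeff 1 (V.e i)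

/-- The coefficient `f_i^{(1)}` of `u^{-1}` in `f_i(u)`. -/
def f₁ (i : ℕ) : V.XRTT := PowerSeries.coeff 1 (V.f i)

end OspSpace

end

/-! The mechanism is that the elements $t_{ij}^{(1)}$ with $i\ne j$ act on $T(u)$ as
$\mathfrak{osp}(V)$ acts on rows and columns. The lowest coefficient in $u^{-1}$ of the RTT relation
shows this (`rtt_coeff_one`, `bracket_t_one`): $P$ contributes the terms with $k=j$ or $l=i$, and
$Q$ the terms with $k=i'$ or $l=j'$. Indices are 0-based, with $i'$ the reflected index.

In the Gauss decomposition $e_1(u)=t_{00}(u)^{-1}t_{01}(u)$ and $f_1(u)=t_{10}(u)t_{00}(u)^{-1}$,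
while every $e_i^{(1)}$, $f_i^{(1)}$ is a single $t_{pq}^{(1)}$ (`coeff_one_gaussE`,
`coeff_one_gaussF`). For $i\ge2$ the indices $p,q$ avoid $0$ and $0'$, so these elements commute
with the even series $t_{00}(u)^{-1}$ (`commute_invDiag`), which factors out of all brackets.

What remains is a computation in the vector representation, on the entries $t_{0j}(u)$ of the first
row for $e$ and $t_{j0}(u)$ of the first column for $f$. In degree 3 the two iterated brackets reach
the same entry with the same scalar. In degrees 4 and 7 the right-hand bracket is a combination of
elements $t_{pq}^{(1)}$ each of which annihilates the entry produced by the left-hand bracket. -/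

noncomputable section

/-! ### Calculus of the supercommutator -/

namespace Superalgebra

theorem C_smul {B : Type*} [Ring B] [Algebra ℂ B] (c : ℂ) (x : B) :
    (C (c • x) : B⟦X⟧) = c • C x := by
  ext n
  rw [PowerSeries.coeff_smul, coeff_C, coeff_C]
  split_ifs <;> simp

variable {B : Type*} [Ring B] [Algebra ℂ B] [Superalgebra B]

theorem evenPart_smul (c : ℂ) (x : B) : evenPart (c • x) = c • evenPart x := by
  simp only [evenPart, map_smul, ← smul_add, smul_comm c]

theorem oddPart_smul (c : ℂ) (x : B) : oddPart (c • x) = c • oddPart x := by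
  simp only [oddPart, map_smul, ← smul_sub, smul_comm c]

theorem bracket_add_right (x y z : B) : ⁅x, y + z⁆ₛ = ⁅x, y⁆ₛ + ⁅x, z⁆ₛ := by
  simp only [bracket, map_add, mul_add, add_mul]; abel

theorem bracket_smul_right (c : ℂ) (x y : B) : ⁅x, c • y⁆ₛ = c • ⁅x, y⁆ₛ := by
  simp only [bracket, map_smul, mul_smul_comm, smul_mul_assoc, smul_sub]

theorem bracket_smul_left (c : ℂ) (x y : B) : ⁅c • x, y⁆ₛ = c • ⁅x, y⁆ₛ := by
  simp only [bracket, evenPart_smul, oddPart_smul, mul_smul_comm, smul_mul_assoc, smul_sub]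

theorem commute_parityAut {h x : B} (hh : parityAut h = h) (hx : Commute h x) :
    Commute h (parityAut x) := by
  simpa [hh] using hx.map (parityAut : B →ₐ[ℂ] B)

theorem commute_evenPart {h x : B} (hh : parityAut h = h) (hx : Commute h x) :
    Commute h (evenPart x) :=
  (hx.add_right (commute_parityAut hh hx)).smul_right _

theorem commute_oddPart {h x : B} (hh : parityAut h = h) (hx : Commute h x) :
    Commute h (oddPart x) :=
  (hx.sub_right (commute_parityAut hh hx)).smul_right _

theorem evenPart_mul_left {h : B} (hh : parityAut h = h) (x : B) :
    evenPart (h * x) = h * evenPart x := by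
  simp only [evenPart, map_mul, hh, mul_smul_comm, mul_add]

theorem oddPart_mul_left {h : B} (hh : parityAut h = h) (x : B) :
    oddPart (h * x) = h * oddPart x := by
  simp only [oddPart, map_mul, hh, mul_smul_comm, mul_sub]

theorem evenPart_mul_right {h : B} (hh : parityAut h = h) (x : B) :
    evenPart (x * h) = evenPart x * h := by
  simp only [evenPart, map_mul, hh, smul_mul_assoc, add_mul]

theorem oddPart_mul_right {h : B} (hh : parityAut h = h) (x : B) :
    oddPart (x * h) = oddPart x * h := by
  simp only [oddPart, map_mul, hh, smul_mul_assoc, sub_mul]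

/-- An even element commuting with `x` may be pulled out of a bracket with `x`. -/
theorem bracket_mul_left_right {h x : B} (hh : parityAut h = h) (hx : Commute h x) (y : B) :
    ⁅x, h * y⁆ₛ = h * ⁅x, y⁆ₛ := by
  simp only [bracket, map_mul, hh, mul_sub, ← mul_assoc, hx.eq]

theorem bracket_mul_right_right {h x : B} (hh : parityAut h = h) (hx : Commute h x) (y : B) :
    ⁅x, y * h⁆ₛ = ⁅x, y⁆ₛ * h := by
  simp only [bracket, map_mul, hh, sub_mul, mul_assoc, (commute_evenPart hh hx).eq,
    (commute_oddPart hh hx).eq]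

theorem bracket_mul_left_left {h x : B} (hh : parityAut h = h) (hx : Commute h x) (y : B) :
    ⁅h * y, x⁆ₛ = h * ⁅y, x⁆ₛ := by
  simp only [bracket, evenPart_mul_left hh, oddPart_mul_left hh, mul_sub, ← mul_assoc, hx.eq,
    (commute_parityAut hh hx).eq]

theorem bracket_mul_right_left {h x : B} (hh : parityAut h = h) (hx : Commute h x) (y : B) :
    ⁅y * h, x⁆ₛ = ⁅y, x⁆ₛ * h := by
  simp only [bracket, evenPart_mul_right hh, oddPart_mul_right hh, sub_mul, mul_assoc, hx.eq]

/-- Super-antisymmetry, needed because in degrees 4 and 7 the current stands in the left slot,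
whereas the RTT relation yields brackets with $t_{ij}^{(1)}$ on the left. -/
theorem bracket_swap {a b : ZMod 2} {x y : B} (hx : IsHomogeneous a x) (hy : IsHomogeneous b y) :
    ⁅y, x⁆ₛ = -superSign (a * b) • ⁅x, y⁆ₛ := by
  rw [bracket_of_isHomogeneous hx hy, bracket_of_isHomogeneous hy hx, smul_sub, smul_smul,
    mul_comm b a, neg_mul, OspSpace.superSign_mul_self]
  simp only [neg_smul, one_smul]
  abel

theorem coeff_parityAut (n : ℕ) (y : B⟦X⟧) :
    coeff n (parityAut y) = parityAut (coeff n y) := by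
  change coeff n (PowerSeries.mapAlgHom parityAut y) = _
  rw [PowerSeries.mapAlgHom_apply, PowerSeries.coeff_map]; rfl

theorem coeff_evenPart (n : ℕ) (y : B⟦X⟧) : coeff n (evenPart y) = evenPart (coeff n y) := by
  simp only [evenPart, PowerSeries.coeff_smul, map_add, coeff_parityAut]

theorem coeff_oddPart (n : ℕ) (y : B⟦X⟧) : coeff n (oddPart y) = oddPart (coeff n y) := by
  simp only [oddPart, PowerSeries.coeff_smul, map_sub, coeff_parityAut]

theorem parityAut_C (x : B) : parityAut (C x : B⟦X⟧) = C (parityAut x) := by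
  ext n
  rw [coeff_parityAut, coeff_C, coeff_C]
  split_ifs <;> simp

theorem evenPart_C (x : B) : evenPart (C x : B⟦X⟧) = C (evenPart x) := by
  simp only [evenPart, parityAut_C, ← map_add, C_smul]

theorem oddPart_C (x : B) : oddPart (C x : B⟦X⟧) = C (oddPart x) := by
  simp only [oddPart, parityAut_C, ← map_sub, C_smul]

theorem bracket_C_C (x y : B) : ⁅(C x : B⟦X⟧), C y⁆ₛ = C ⁅x, y⁆ₛ := by
  simp only [bracket, evenPart_C, oddPart_C, parityAut_C, map_sub, map_mul]

/-- Bracketing with a constant series acts coefficientwise. This lifts the action from coefficients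
to series, and later brings relations between currents down to relations between
$u^{-1}$-coefficients. -/
theorem coeff_bracket_C_left (n : ℕ) (x : B) (y : B⟦X⟧) :
    coeff n ⁅C x, y⁆ₛ = ⁅x, coeff n y⁆ₛ := by
  simp only [bracket, evenPart_C, oddPart_C, map_sub, coeff_C_mul, coeff_mul_C, coeff_parityAut]

theorem coeff_bracket_C_right (n : ℕ) (x : B⟦X⟧) (y : B) :
    coeff n ⁅x, C y⁆ₛ = ⁅coeff n x, y⁆ₛ := by
  simp only [bracket, parityAut_C, map_sub, coeff_C_mul, coeff_mul_C, coeff_evenPart,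
    coeff_oddPart]

theorem IsHomogeneous.C {a : ZMod 2} {x : B} (hx : IsHomogeneous a x) :
    IsHomogeneous a (PowerSeries.C x : B⟦X⟧) := by
  unfold IsHomogeneous at *
  rw [parityAut_C, hx, C_smul]

theorem IsHomogeneous.coeff {a : ZMod 2} {x : B⟦X⟧} (hx : IsHomogeneous a x) (n : ℕ) :
    IsHomogeneous a (PowerSeries.coeff n x) := by
  unfold IsHomogeneous at *
  rw [← coeff_parityAut, hx, PowerSeries.coeff_smul]

end Superalgebra

/-! ### Low order coefficients of the Gauss decomposition -/

section Gauss

variable {B : Type*} [Ring B] {d : ℕ} (T : Matrix (Fin d) (Fin d) B⟦X⟧)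

theorem coeff_one_mul_eq (x y : B⟦X⟧) :
    coeff 1 (x * y) = constantCoeff x * coeff 1 y + coeff 1 x * constantCoeff y := by
  rw [coeff_mul, Finset.Nat.antidiagonal_succ]
  simp

/-- Each elimination step subtracts a product whose two outer factors are off-diagonal and so have
zero constant term; the correction starts in order 2. -/
theorem coeff_one_gaussStep (hT : ∀ i j, constantCoeff (T i j) = if i = j then 1 else 0) (k : ℕ)
    (i j : Fin d) (hi : k ≤ i) (hj : k ≤ j) : coeff 1 (gaussStep T k i j) = coeff 1 (T i j) := by
  induction k generalizing i j with
  | zero => rfl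
  | succ k ih =>
    have hk : k < d := by omega
    have hj' : (⟨k, hk⟩ : Fin d) ≠ j := by rintro rfl; simp at hj
    have hi' : i ≠ (⟨k, hk⟩ : Fin d) := by rintro rfl; simp at hi
    have h1 := constantCoeff_gaussStep T hT k ⟨k, hk⟩ j le_rfl (by omega)
    have h2 := constantCoeff_gaussStep T hT k i ⟨k, hk⟩ (by omega) le_rfl
    rw [if_neg hj'] at h1
    rw [if_neg hi'] at h2
    simp only [gaussStep, dif_pos hk, map_sub, coeff_one_mul_eq, map_mul, h1, h2]
    simpa using ih i j (by omega) (by omega)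

theorem coeff_one_gaussE (hT : ∀ i j, constantCoeff (T i j) = if i = j then 1 else 0)
    {i j : Fin d} (h : i < j) : coeff 1 (gaussE T i j) = coeff 1 (T i j) := by
  have h1 := constantCoeff_gaussStep T hT i i j le_rfl h.le
  rw [if_neg h.ne] at h1
  rw [gaussE, if_pos h, coeff_one_mul_eq, h1, coeff_one_gaussStep T hT i i j le_rfl h.le]
  simp

theorem coeff_one_gaussF (hT : ∀ i j, constantCoeff (T i j) = if i = j then 1 else 0)
    {i j : Fin d} (h : i < j) : coeff 1 (gaussF T j i) = coeff 1 (T j i) := by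
  have h1 := constantCoeff_gaussStep T hT i j i h.le le_rfl
  rw [if_neg h.ne'] at h1
  rw [gaussF, if_pos h, coeff_one_mul_eq, h1, coeff_one_gaussStep T hT i j i h.le le_rfl]
  simp

end Gauss

end

/-! ### The RTT relation in components and its lowest coefficient -/

noncomputable section

namespace OspSpace

variable {d : ℕ} (V : OspSpace d)

/-- For an even first factor, the product of tensors is given by an explicit sign rule. -/
theorem IsEvenTensor.tmul_apply {B : Type*} [Ring B] [Algebra ℂ B] [Superalgebra B]
    {M : V.Tensor2 B} (h : V.IsEvenTensor M) (M' : V.Tensor2 B) (i j k l : Fin d) :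
    V.tmul M M' i j k l = ∑ a, ∑ c,
      superSign ((V.parity k + V.parity c) * (V.parity a + V.parity j) +
        (V.parity a + V.parity j + (V.parity c + V.parity l)) *
          (V.parity i + V.parity a + V.parity k + V.parity c)) • (M i a k c * M' a j c l) := by
  unfold OspSpace.tmul
  refine Finset.sum_congr rfl fun a _ => Finset.sum_congr rfl fun c _ => ?_
  rw [superSign_add, mul_smul]
  congr 1
  -- On the homogeneous entries of `M` the parity involution is itself a sign, so the case
  -- distinction in `tmul` becomes one more term in the exponent.
  have h2 : ∀ z : ZMod 2, z = 0 ∨ z = 1 := by decide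
  split_ifs with h0
  · rw [h0, zero_mul]; simp [superSign]
  · rw [(h2 _).resolve_left h0, one_mul, h i a k c, smul_mul_assoc]

/-- The sign of the `(a, c)` summand in a component of the left-hand side of the RTT relation. -/
def signLHS (i j k l a c : Fin d) : ℂ :=
  superSign
    ((V.parity c + V.parity l) * (V.parity i + V.parity j + V.parity k + V.parity c) +
          (V.parity a + V.parity j) * (V.parity i + V.parity a) +
          (V.parity a * V.parity j + V.parity j) + (V.parity c * V.parity l + V.parity l))

/-- The sign of the `(a, c)` summand in a component of the right-hand side of the RTT relation. -/
def signRHS (i j k l a c : Fin d) : ℂ :=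
  superSign
    ((V.parity k + V.parity c) * (V.parity a + V.parity j) +
          (V.parity a + V.parity j + (V.parity c + V.parity l)) *
            (V.parity i + V.parity a + V.parity k + V.parity c) +
          (V.parity k * V.parity c + V.parity c) + (V.parity i * V.parity a + V.parity a))

/-- $T_1$ is the identity in the second factor and $T_2$ in the first, so two of the four summation
indices are forced. The accumulated signs are compared as functions on $\mathbb Z/2$, by
enumeration. -/
theorem rttLHS_apply (i j k l : Fin d) :
    V.rttLHS i j k l = ∑ a, ∑ c,
      V.signLHS i j k l a c •
      (V.clearedR i a k c *
        (PowerSeries.C (V.freeT a j) * PowerSeries.map PowerSeries.C (V.freeT c l))) := by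
  unfold rttLHS
  rw [IsEvenTensor.tmul_apply V (IsEvenTensor.tmul V V.isEvenTensor_clearedR V.isEvenTensor_T1),
    Finset.sum_eq_single j, Finset.sum_comm]
  rotate_left
  · intro b _ hb
    refine Finset.sum_eq_zero fun c _ => ?_
    rw [T2, if_neg hb, mul_zero, smul_zero]
  · simp
  refine Finset.sum_congr rfl fun c _ => ?_
  rw [IsEvenTensor.tmul_apply V V.isEvenTensor_clearedR, T2, if_pos rfl, Finset.sum_mul,
    Finset.smul_sum]
  refine Finset.sum_congr rfl fun a _ => ?_
  rw [Finset.sum_eq_single c, T1, if_pos rfl]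
  · simp only [mul_smul_comm, smul_mul_assoc, smul_smul, mul_assoc]
    congr 1
    simp only [signLHS, ← superSign_add]
    congr 1
    generalize V.parity i = i, V.parity j = j, V.parity k = k, V.parity l = l, V.parity a = a,
      V.parity c = c
    revert i j k l a c
    decide
  · intro e _ he
    rw [T1, if_neg he, mul_zero, smul_zero]
  · simp

theorem rttRHS_apply (i j k l : Fin d) :
    V.rttRHS i j k l = ∑ a, ∑ c,
      V.signRHS i j k l a c •
      ((PowerSeries.map PowerSeries.C (V.freeT k c) * PowerSeries.C (V.freeT i a)) *
        V.clearedR a j c l) := by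
  unfold rttRHS
  rw [IsEvenTensor.tmul_apply V (IsEvenTensor.tmul V V.isEvenTensor_T2 V.isEvenTensor_T1)]
  refine Finset.sum_congr rfl fun a _ => Finset.sum_congr rfl fun c _ => ?_
  rw [IsEvenTensor.tmul_apply V V.isEvenTensor_T2, Finset.sum_eq_single i,
    Finset.sum_eq_single c, T1, if_pos rfl, T2, if_pos rfl]
  · simp only [mul_smul_comm, smul_mul_assoc, smul_smul]
    congr 1
    simp only [signRHS, ← superSign_add]
    congr 1
    generalize V.parity i = i, V.parity j = j, V.parity k = k, V.parity l = l, V.parity a = a,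
      V.parity c = c
    revert i j k l a c
    decide
  · intro e _ he
    rw [T1, if_neg he, mul_zero, smul_zero]
  · simp
  · intro b _ hb
    refine Finset.sum_eq_zero fun c _ => ?_
    rw [T2, if_neg hb.symm, zero_mul, smul_zero]
  · simp

theorem coeff_invU_mul_zero (s : ℕ) (Z : V.Free⟦X⟧⟦X⟧) : coeff 0 (coeff s (V.invU * Z)) = 0 := by
  rw [invU, coeff_C_mul]; simp

theorem coeff_invU_mul_succ (r s : ℕ) (Z : V.Free⟦X⟧⟦X⟧) :
    coeff (r + 1) (coeff s (V.invU * Z)) = coeff r (coeff s Z) := by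
  rw [invU, coeff_C_mul, coeff_succ_X_mul]

theorem coeff_invV_mul_succ (r s : ℕ) (Z : V.Free⟦X⟧⟦X⟧) :
    coeff r (coeff (s + 1) (V.invV * Z)) = coeff r (coeff s Z) := by
  rw [invV, coeff_succ_X_mul]

theorem commute_invU (Z : V.Free⟦X⟧⟦X⟧) : Commute V.invU Z := by
  ext s : 1
  rw [invU, coeff_C_mul, coeff_mul_C]
  exact ((PowerSeries.commute_X _).eq).symm

theorem commute_invV (Z : V.Free⟦X⟧⟦X⟧) : Commute V.invV Z := (PowerSeries.commute_X Z).symm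

/-- The entries are polynomials in the central variables $u^{-1}$, $v^{-1}$. Hence $R$ can be moved
to the front on the right-hand side of the RTT relation too, and one coefficient formula serves both
sides. -/
theorem commute_clearedR (i j k l : Fin d) (Z : V.Free⟦X⟧⟦X⟧) : Commute (V.clearedR i j k l) Z := by
  have hu := V.commute_invU Z
  have hv := V.commute_invV Z
  have h := (hv.sub_left hu).sub_left ((hu.mul_left hv).smul_left V.kappa)
  exact (((((hv.sub_left hu).mul_left h).smul_left _).sub_left
    (((hu.mul_left hv).mul_left h).smul_left _))).add_left
      (((hu.mul_left hv).mul_left (hv.sub_left hu)).smul_left _)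

/-- The leading coefficient in `u^{-1}` of a multiple of the `R`-matrix. -/
theorem coeff_one_clearedR_mul (i j k l : Fin d) (n : ℕ) (Z : V.Free⟦X⟧⟦X⟧) :
    coeff 1 (coeff (n + 2) (V.clearedR i j k l * Z)) =
      V.opI i j k l • (coeff 1 (coeff n Z) - (2 : ℂ) • coeff 0 (coeff (n + 1) Z)
        - V.kappa • coeff 0 (coeff n Z))
      - V.opP i j k l • coeff 0 (coeff n Z) + V.opQ i j k l • coeff 0 (coeff n Z) := by
  have hu : ∀ (s : ℕ) (W : V.Free⟦X⟧⟦X⟧),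
      coeff 1 (coeff s (V.invU * W)) = coeff 0 (coeff s W) := V.coeff_invU_mul_succ 0
  unfold clearedR
  simp only [add_mul, sub_mul, mul_sub, smul_mul_assoc, mul_smul_comm, mul_assoc, map_add, map_sub,
    PowerSeries.coeff_smul, smul_sub, hu, coeff_invV_mul_succ, coeff_invU_mul_zero, smul_zero, sub_zero]
  -- The monomials of degree at most 1 in $x=u^{-1}$ are $y^2-2xy-\kappa xy^2$ for the identity part
  -- and $xy^2$ for $P$ and $Q$, where $y=v^{-1}$.
  module

/-- The generators `t_{ij}^{(n)}` in `X^rtt(osp(V))`, with `t_{ij}^{(0)} = δ_{ij}`. -/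
def t (i j : Fin d) (n : ℕ) : V.XRTT := PowerSeries.coeff n (V.T i j)

theorem t_zero (i j : Fin d) : V.t i j 0 = if i = j then 1 else 0 := by
  rw [t, coeff_zero_eq_constantCoeff_apply, constantCoeff_T]

theorem mk_coeff_freeT (i j : Fin d) (n : ℕ) :
    RingQuot.mkAlgHom ℂ V.RTTRel (PowerSeries.coeff n (V.freeT i j)) = V.t i j n := by
  rw [t, T, PowerSeries.coeff_map]; rfl

theorem coeff_C_mul_map_C {R : Type*} [Ring R] (f g : R⟦X⟧) (r s : ℕ) :
    coeff r (coeff s (PowerSeries.C f * PowerSeries.map PowerSeries.C g)) =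
      coeff r f * coeff s g := by
  rw [coeff_C_mul, coeff_map, coeff_mul_C]

theorem coeff_map_C_mul_C {R : Type*} [Ring R] (f g : R⟦X⟧) (r s : ℕ) :
    coeff r (coeff s (PowerSeries.map PowerSeries.C g * PowerSeries.C f)) =
      coeff s g * coeff r f := by
  rw [coeff_mul_C, coeff_map, coeff_C_mul]

theorem isHomogeneous_T (i j : Fin d) :
    Superalgebra.IsHomogeneous (V.parity i + V.parity j) (V.T i j) := by
  unfold Superalgebra.IsHomogeneous
  ext n
  have h := congrArg (PowerSeries.coeff n) (V.parityAut_freeT i j)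
  rw [Superalgebra.coeff_parityAut, PowerSeries.coeff_smul] at h
  rw [Superalgebra.coeff_parityAut, PowerSeries.coeff_smul]
  change V.xParityAut (V.t i j n) = superSign _ • V.t i j n
  rw [← mk_coeff_freeT, xParityAut_mk, h, map_smul]

theorem sum_ite_add_ite {A : Type*} [AddCommMonoid A] (p q r : Fin d) (F G : Fin d → Fin d → A) :
    ∑ a, ∑ c, ((if a = p then if c = q then F a c else 0 else 0) + (if a = r then G a c else 0)) =
      F p q + ∑ c, G r c := by
  simp only [Finset.sum_add_distrib]
  rw [Finset.sum_comm (f := fun a c => if a = r then G a c else 0)]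
  simp

theorem isHomogeneous_t (i j : Fin d) (n : ℕ) :
    Superalgebra.IsHomogeneous (V.parity i + V.parity j) (V.t i j n) :=
  (V.isHomogeneous_T i j).coeff n

theorem sum_smul_ite_sub_ite {A : Type*} [AddCommGroup A] [Module ℂ A] (P Q : Prop) [Decidable P]
    [Decidable Q] (p q : Fin d) (σ : Fin d → ℂ) (x y : ℂ) (f : Fin d → A) :
    ∑ c, (σ c * ((if P ∧ c = p then x else 0) - (if Q ∧ c = q then y else 0))) • f c =
      (if P then σ p * x else 0) • f p - (if Q then σ q * y else 0) • f q := by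
  simp only [mul_sub, sub_smul, Finset.sum_sub_distrib]
  congr 1 <;> split_ifs <;> simp [*]

/-- The `u^{-1}`-coefficient of the RTT relation, in terms of components. -/
theorem rtt_coeff_one {i j : Fin d} (hij : i ≠ j) (k l : Fin d) (n : ℕ) :
    V.signLHS i j k l i k • (V.t i j 1 * V.t k l n)
      + ∑ c, (V.signLHS i j k l j c * (V.opQ i j k c - V.opP i j k c)) • V.t c l n
    = V.signRHS i j k l j l • (V.t k l n * V.t i j 1)
      + ∑ c, (V.signRHS i j k l i c * (V.opQ i j c l - V.opP i j c l)) • V.t k c n := by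
  -- The shift by 2 compensates the leading term $v^{-2}$ of the cleared $R$-matrix.
  have h := RingQuot.mkAlgHom_rel ℂ (RTTRel.rtt (V := V) i j k l 1 (n + 2))
  rw [rttLHS_apply, rttRHS_apply] at h
  simp only [map_sum, PowerSeries.coeff_smul, map_smul, (V.commute_clearedR _ _ _ _ _).symm.eq,
    coeff_one_clearedR_mul, coeff_C_mul_map_C, coeff_map_C_mul_C, map_add, map_sub, map_mul,
    mk_coeff_freeT, t_zero] at h
  -- Since $i\ne j$, the identity part survives only at $a=i$, where the constant terms
  -- $\delta_{aj}$ vanish, and with them $\kappa$; $P$ and $Q$ survive only at $a=j$. The right-hand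
  -- side is symmetric.
  have hL : ∀ a c : Fin d,
      V.signLHS i j k l a c • (V.opI i a k c • (V.t a j 1 * V.t c l n
        - (2 : ℂ) • ((if a = j then 1 else 0) * V.t c l (n + 1))
        - V.kappa • ((if a = j then 1 else 0) * V.t c l n))
        - V.opP i a k c • ((if a = j then 1 else 0) * V.t c l n)
        + V.opQ i a k c • ((if a = j then 1 else 0) * V.t c l n))
      = (if a = i then if c = k then V.signLHS i j k l a c • (V.t a j 1 * V.t c l n) else 0 else 0)
        + (if a = j then (V.signLHS i j k l a c * (V.opQ i a k c - V.opP i a k c)) • V.t c l n else 0) := by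
    intro a c
    unfold opI
    by_cases ha : a = j
    · subst ha
      simp only [hij, hij.symm, false_and, if_false, if_true, one_mul, zero_smul, zero_add, zero_sub]
      module
    · by_cases hi : a = i
      · subst hi
        by_cases hc : c = k
        · subst hc; simp [hij]
        · simp [hij, hc, Ne.symm hc]
      · simp [ha, hi, Ne.symm hi]
  have hR : ∀ a c : Fin d,
      V.signRHS i j k l a c • (V.opI a j c l • (V.t k c n * V.t i a 1
        - (2 : ℂ) • (V.t k c (n + 1) * (if i = a then 1 else 0))
        - V.kappa • (V.t k c n * (if i = a then 1 else 0)))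
        - V.opP a j c l • (V.t k c n * (if i = a then 1 else 0))
        + V.opQ a j c l • (V.t k c n * (if i = a then 1 else 0)))
      = (if a = j then if c = l then V.signRHS i j k l a c • (V.t k c n * V.t i a 1) else 0 else 0)
        + (if a = i then (V.signRHS i j k l a c * (V.opQ a j c l - V.opP a j c l)) • V.t k c n else 0) := by
    intro a c
    unfold opI
    by_cases ha : a = i
    · subst ha
      simp only [hij, false_and, if_false, if_true, mul_one, zero_smul, zero_add, zero_sub]
      module
    · by_cases hi : a = j
      · subst hi
        by_cases hc : c = l
        · subst hc; simp [hij, Ne.symm hij]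
        · simp [hij, Ne.symm hij, hc]
      · simp [ha, hi, Ne.symm ha]
  simpa only [hL, hR, sum_ite_add_ite] using h

/-- The action of `t_{ij}^{(1)}` on `T(u)`. -/
theorem bracket_t_one {i j : Fin d} (hij : i ≠ j) (k l : Fin d) (n : ℕ) :
    ⁅V.t i j 1, V.t k l n⁆ₛ =
      (if k = j then superSign (V.parity j) else 0) • V.t i l n
      - (if l = i then superSign (V.parity i * V.parity j + V.parity i * V.parity k
          + V.parity j * V.parity k) else 0) • V.t k j n
      - (if k = i.rev then superSign (V.parity i + V.parity j + V.parity i * V.parity j)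
          * V.theta i * V.theta j else 0) • V.t j.rev l n
      + (if l = j.rev then superSign (V.parity k * V.parity j + V.parity k * V.parity i + V.parity j)
          * V.theta i * V.theta j else 0) • V.t k i.rev n := by
  have h := V.rtt_coeff_one hij k l n
  rw [Superalgebra.bracket_of_isHomogeneous (V.isHomogeneous_t i j 1) (V.isHomogeneous_t k l n)]
  have hσ : V.signLHS i j k l i k * V.signLHS i j k l i k = 1 := superSign_mul_self _
  have hL : ∑ c, (V.signLHS i j k l j c * (V.opQ i j k c - V.opP i j k c)) • V.t c l n =
      (if k = i.rev then V.signLHS i j k l j j.rev * (superSign (V.parity i * V.parity j) *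
        V.theta i * V.theta j) else 0) • V.t j.rev l n
      - (if k = j then V.signLHS i j k l j i * superSign (V.parity j) else 0) • V.t i l n := by
    exact sum_smul_ite_sub_ite ..
  have hR : ∑ c, (V.signRHS i j k l i c * (V.opQ i j c l - V.opP i j c l)) • V.t k c n =
      (if l = j.rev then V.signRHS i j k l i i.rev * (superSign (V.parity i * V.parity j) *
        V.theta i * V.theta j) else 0) • V.t k i.rev n
      - (if l = i then V.signRHS i j k l i j * superSign (V.parity j) else 0) • V.t k j n := by
    simp only [opQ, opP, and_comm (b := l = _)]
    exact sum_smul_ite_sub_ite ..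
  rw [hL, hR] at h
  -- Multiplying by a sign, which squares to 1, normalises the coefficient of
  -- $t_{ij}^{(1)}t_{kl}^{(n)}$ to 1. The equalities `e0`–`e4` then match the remaining signs by
  -- enumerating parities, after imposing the index condition under which a term occurs.
  have h' := congrArg (V.signLHS i j k l i k • ·) h
  simp only [smul_add, smul_sub, smul_smul, hσ, one_smul, mul_ite, mul_zero] at h'
  have e0 : superSign ((V.parity i + V.parity j) * (V.parity k + V.parity l)) =
      V.signLHS i j k l i k * V.signRHS i j k l j l := by
    simp only [signLHS, signRHS, ← superSign_add]
    congr 1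
    generalize V.parity i = i, V.parity j = j, V.parity k = k, V.parity l = l
    revert i j k l
    decide
  have e1 : (if k = j then superSign (V.parity j) else 0) = if k = j then
      V.signLHS i j k l i k * (V.signLHS i j k l j i * superSign (V.parity j)) else 0 := by
    split_ifs with hk
    · subst hk
      simp only [signLHS, ← superSign_add]
      congr 1
      generalize V.parity i = i, V.parity k = k, V.parity l = l
      revert i k l
      decide
    · rfl
  have e2 : (if l = i then superSign (V.parity i * V.parity j + V.parity i * V.parity k
          + V.parity j * V.parity k) else 0) = if l = i then
      V.signLHS i j k l i k * (V.signRHS i j k l i j * superSign (V.parity j)) else 0 := by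
    split_ifs with hk
    · subst hk
      simp only [signLHS, signRHS, ← superSign_add]
      congr 1
      generalize V.parity j = i, V.parity k = k, V.parity l = l
      revert i k l
      decide
    · rfl
  have e3 : (if k = i.rev then superSign (V.parity i + V.parity j + V.parity i * V.parity j)
          * V.theta i * V.theta j else 0) = if k = i.rev then
      V.signLHS i j k l i k * (V.signLHS i j k l j j.rev * (superSign (V.parity i * V.parity j) *
        V.theta i * V.theta j)) else 0 := by
    split_ifs with hk
    · subst hk
      simp only [signLHS, ← mul_assoc, ← superSign_add, V.parity_rev]
      congr 3
      generalize V.parity i = i, V.parity j = k, V.parity l = l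
      revert i k l
      decide
    · rfl
  have e4 : (if l = j.rev then superSign (V.parity k * V.parity j + V.parity k * V.parity i
          + V.parity j) * V.theta i * V.theta j else 0) = if l = j.rev then
      V.signLHS i j k l i k * (V.signRHS i j k l i i.rev * (superSign (V.parity i * V.parity j) *
        V.theta i * V.theta j)) else 0 := by
    split_ifs with hk
    · subst hk
      simp only [signLHS, signRHS, ← mul_assoc, ← superSign_add, V.parity_rev]
      congr 3
      generalize V.parity i = i, V.parity j = k, V.parity k = l
      revert i k l
      decide
    · rfl
  rw [e0, e1, e2, e3, e4, sub_eq_iff_eq_add]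
  rw [← eq_sub_iff_add_eq] at h'
  rw [h']
  abel

theorem bracket_t_one_T {i j : Fin d} (hij : i ≠ j) (k l : Fin d) :
    ⁅C (V.t i j 1), V.T k l⁆ₛ =
      (if k = j then superSign (V.parity j) else 0) • V.T i l
      - (if l = i then superSign (V.parity i * V.parity j + V.parity i * V.parity k
          + V.parity j * V.parity k) else 0) • V.T k j
      - (if k = i.rev then superSign (V.parity i + V.parity j + V.parity i * V.parity j)
          * V.theta i * V.theta j else 0) • V.T j.rev l
      + (if l = j.rev then superSign (V.parity k * V.parity j + V.parity k * V.parity i + V.parity j)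
          * V.theta i * V.theta j else 0) • V.T k i.rev := by
  ext n
  rw [Superalgebra.coeff_bracket_C_left, map_add, map_sub, map_sub]
  simp only [PowerSeries.coeff_smul]
  exact V.bracket_t_one hij k l n

end OspSpace
end

noncomputable section

namespace OspSpace

open Superalgebra

variable {d : ℕ} (V : OspSpace d)

/-! ### Cases of the action with at most one surviving term -/

section SpecialCases

variable {i j k l : Fin d}

theorem bracket_t_T_eq_zero (hij : i ≠ j) (h₁ : k ≠ j) (h₂ : l ≠ i) (h₃ : k ≠ i.rev)
    (h₄ : l ≠ j.rev) : ⁅C (V.t i j 1), V.T k l⁆ₛ = 0 := by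
  simp [bracket_t_one_T V hij, *]

theorem bracket_t_T_of_row (hij : i ≠ j) (h₂ : l ≠ i) (h₃ : j ≠ i.rev) (h₄ : l ≠ j.rev) :
    ⁅C (V.t i j 1), V.T j l⁆ₛ = superSign (V.parity j) • V.T i l := by
  simp [bracket_t_one_T V hij, *]

theorem bracket_t_T_of_col (hij : i ≠ j) (h₁ : k ≠ j) (h₃ : k ≠ i.rev) (h₄ : i ≠ j.rev) :
    ⁅C (V.t i j 1), V.T k i⁆ₛ = (-superSign (V.parity i * V.parity j + V.parity i * V.parity k
      + V.parity j * V.parity k)) • V.T k j := by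
  simp [bracket_t_one_T V hij, *]

theorem bracket_t_T_of_row_rev (hij : i ≠ j) (h₁ : i.rev ≠ j) (h₂ : l ≠ i) (h₄ : l ≠ j.rev) :
    ⁅C (V.t i j 1), V.T i.rev l⁆ₛ =
      (-(superSign (V.parity i + V.parity j + V.parity i * V.parity j) * V.theta i * V.theta j)) •
        V.T j.rev l := by
  simp [bracket_t_one_T V hij, *]

theorem bracket_t_T_of_col_rev (hij : i ≠ j) (h₁ : k ≠ j) (h₂ : j.rev ≠ i) (h₃ : k ≠ i.rev) :
    ⁅C (V.t i j 1), V.T k j.rev⁆ₛ =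
      (superSign (V.parity k * V.parity j + V.parity k * V.parity i + V.parity j)
        * V.theta i * V.theta j) • V.T k i.rev := by
  simp [bracket_t_one_T V hij, *]

theorem bracket_T_t {p q : Fin d} {c : ℂ} (h : ⁅C (V.t i j 1), V.T k l⁆ₛ = c • V.T p q) :
    ⁅V.T k l, C (V.t i j 1)⁆ₛ =
      (-superSign ((V.parity i + V.parity j) * (V.parity k + V.parity l)) * c) • V.T p q := by
  rw [bracket_swap (V.isHomogeneous_t i j 1).C (V.isHomogeneous_T k l), h, smul_smul]

theorem bracket_T_t_eq_zero (h : ⁅C (V.t i j 1), V.T k l⁆ₛ = 0) :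
    ⁅V.T k l, C (V.t i j 1)⁆ₛ = 0 := by
  rw [bracket_swap (V.isHomogeneous_t i j 1).C (V.isHomogeneous_T k l), h, smul_zero]

theorem bracket_t_t {p q : Fin d} {c : ℂ} (h : ⁅C (V.t i j 1), V.T k l⁆ₛ = c • V.T p q) (n : ℕ) :
    ⁅V.t i j 1, V.t k l n⁆ₛ = c • V.t p q n := by
  have h' := congrArg (PowerSeries.coeff n) h
  rwa [coeff_bracket_C_left, PowerSeries.coeff_smul] at h'

end SpecialCases

/-- The inverse of the series `t_{pp}(u)`. -/
def invDiag (p : Fin d) : V.XRTT⟦X⟧ := invOfUnit (V.T p p) 1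

theorem T_mul_invDiag (p : Fin d) : V.T p p * V.invDiag p = 1 :=
  mul_invOfUnit _ _ (by simp [constantCoeff_T])

theorem invDiag_mul_T (p : Fin d) : V.invDiag p * V.T p p = 1 :=
  invOfUnit_mul _ _ (by simp [constantCoeff_T])

theorem isHomogeneous_T_diag (p : Fin d) : IsHomogeneous 0 (V.T p p) := by
  simpa only [CharTwo.add_self_eq_zero] using V.isHomogeneous_T p p

theorem parityAut_invDiag (p : Fin d) : parityAut (V.invDiag p) = V.invDiag p := by
  have h : parityAut (V.T p p) = V.T p p := by
    simpa [IsHomogeneous, superSign] using V.isHomogeneous_T_diag p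
  have h1 : parityAut (V.invDiag p) * V.T p p = 1 := by
    rw [← h, ← map_mul, invDiag_mul_T, map_one]
  exact left_inv_eq_right_inv h1 (V.T_mul_invDiag p)

/-- All four terms of the action vanish on $t_{pp}(u)$. As this series is even, the zero
supercommutator is a zero commutator, and commutation passes to the inverse. -/
theorem commute_invDiag {i j p : Fin d} (hij : i ≠ j) (h₁ : p ≠ j) (h₂ : p ≠ i) (h₃ : p ≠ i.rev)
    (h₄ : p ≠ j.rev) : Commute (V.invDiag p) (C (V.t i j 1)) := by
  have h := V.bracket_t_T_eq_zero hij h₁ h₂ h₃ h₄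
  rw [bracket_of_isHomogeneous (V.isHomogeneous_t i j 1).C (V.isHomogeneous_T_diag p), mul_zero,
    superSign, if_pos rfl, one_smul, sub_eq_zero] at h
  calc V.invDiag p * C (V.t i j 1)
      = V.invDiag p * (C (V.t i j 1) * V.T p p) * V.invDiag p := by
        rw [mul_assoc, mul_assoc, T_mul_invDiag, mul_one]
    _ = C (V.t i j 1) * V.invDiag p := by
        rw [h, ← mul_assoc, invDiag_mul_T, one_mul]

/-- No elimination precedes the first pivot, so the equality is definitional. -/
theorem gaussE_zero {d : ℕ} (V : OspSpace (d + 2)) :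
    gaussE V.T 0 1 = V.invDiag 0 * V.T 0 1 := rfl

theorem gaussF_zero {d : ℕ} (V : OspSpace (d + 2)) :
    gaussF V.T 1 0 = V.T 1 0 * V.invDiag 0 := rfl

theorem coeff_one_gaussE_T {i j : Fin d} (h : i < j) : coeff 1 (gaussE V.T i j) = V.t i j 1 :=
  coeff_one_gaussE V.T V.constantCoeff_T h

theorem coeff_one_gaussF_T {i j : Fin d} (h : i < j) : coeff 1 (gaussF V.T j i) = V.t j i 1 :=
  coeff_one_gaussF V.T V.constantCoeff_T h

theorem coeff_one_e (i : ℕ) : coeff 1 (V.e i) = V.e₁ i := rfl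

theorem coeff_one_f (i : ℕ) : coeff 1 (V.f i) = V.f₁ i := rfl

/-! ### The higher order relations -/

section DegreeThree

variable (V : OspSpace 6)

/-- The columns move $1\to2\to4$ in one order and $1\to3\to4$ in the other. As $v_2$ is even, $e_3$
sits at position $(1,3)$. -/
theorem degree_three_e {a : ZMod 2} (hV : V.paritySeq = ![a, 1, 0]) :
    ⁅C (V.e₁ 3), ⁅C (V.e₁ 2), V.e 1⁆ₛ⁆ₛ - ⁅C (V.e₁ 2), ⁅C (V.e₁ 3), V.e 1⁆ₛ⁆ₛ = 0 := by
  have p0 : V.parity 0 = a := congrFun hV 0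
  have p1 : V.parity 1 = 1 := congrFun hV 1
  have p2 : V.parity 2 = 0 := congrFun hV 2
  have p3 : V.parity 3 = 0 := (V.parity_rev 2).trans p2
  have e1 : V.e 1 = V.invDiag 0 * V.T 0 1 := by
    rw [← gaussE_zero]; simp [e, simplePos]
  have e2 : V.e₁ 2 = V.t 1 2 1 := by
    rw [← V.coeff_one_gaussE_T (by decide)]; simp [e₁, e, simplePos]
  have e3 : V.e₁ 3 = V.t 1 3 1 := by
    rw [← V.coeff_one_gaussE_T (by decide)]
    simp [e₁, e, simplePos, p2, show Even 6 by decide]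
  have t1 : V.theta 1 = 1 := by simp [theta]
  have t2 : V.theta 2 = 1 := by simp [theta]
  have t3 : V.theta 3 = 1 := by simp [theta, p3, superSign]
  have hh := V.parityAut_invDiag 0
  have c12 := V.commute_invDiag (i := 1) (j := 2) (p := 0)
    (by decide) (by decide) (by decide) (by decide) (by decide)
  have c13 := V.commute_invDiag (i := 1) (j := 3) (p := 0)
    (by decide) (by decide) (by decide) (by decide) (by decide)
  have b1 := V.bracket_t_T_of_col (i := 1) (j := 2) (k := 0)
    (by decide) (by decide) (by decide) (by decide)
  -- For $d=6$ one has $2=3'$ and $4=1'$; the second move in each order comes from the $Q$-term.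
  have b2 : ⁅C (V.t 1 3 1), V.T 0 2⁆ₛ = _ • V.T 0 4 := V.bracket_t_T_of_col_rev
    (by decide) (by decide) (by decide) (by decide)
  have b3 := V.bracket_t_T_of_col (i := 1) (j := 3) (k := 0)
    (by decide) (by decide) (by decide) (by decide)
  have b4 : ⁅C (V.t 1 2 1), V.T 0 3⁆ₛ = _ • V.T 0 4 := V.bracket_t_T_of_col_rev
    (by decide) (by decide) (by decide) (by decide)
  rw [e1, e2, e3, bracket_mul_left_right hh c12, bracket_mul_left_right hh c13,
    bracket_mul_left_right hh c13, bracket_mul_left_right hh c12, b1, b3, bracket_smul_right,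
    bracket_smul_right, b2, b4]
  -- The two scalars differ by exchanging the indices 2 and 3, whose parities and $\theta$-values
  -- agree.
  simp only [p0, p1, p2, p3, t1, t2, t3, sub_self]

theorem degree_three_f {a : ZMod 2} (hV : V.paritySeq = ![a, 1, 0]) :
    ⁅C (V.f₁ 3), ⁅C (V.f₁ 2), V.f 1⁆ₛ⁆ₛ - ⁅C (V.f₁ 2), ⁅C (V.f₁ 3), V.f 1⁆ₛ⁆ₛ = 0 := by
  have p0 : V.parity 0 = a := congrFun hV 0
  have p1 : V.parity 1 = 1 := congrFun hV 1
  have p2 : V.parity 2 = 0 := congrFun hV 2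
  have p3 : V.parity 3 = 0 := (V.parity_rev 2).trans p2
  have e1 : V.f 1 = V.T 1 0 * V.invDiag 0 := by
    rw [← gaussF_zero]; simp [f, simplePos]
  have e2 : V.f₁ 2 = V.t 2 1 1 := by
    rw [← V.coeff_one_gaussF_T (by decide)]; simp [f₁, f, simplePos]
  have e3 : V.f₁ 3 = V.t 3 1 1 := by
    rw [← V.coeff_one_gaussF_T (by decide)]
    simp [f₁, f, simplePos, p2, show Even 6 by decide]
  have t1 : V.theta 1 = 1 := by simp [theta]
  have t2 : V.theta 2 = 1 := by simp [theta]
  have t3 : V.theta 3 = 1 := by simp [theta, p3, superSign]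
  have hh := V.parityAut_invDiag 0
  have c21 := V.commute_invDiag (i := 2) (j := 1) (p := 0)
    (by decide) (by decide) (by decide) (by decide) (by decide)
  have c31 := V.commute_invDiag (i := 3) (j := 1) (p := 0)
    (by decide) (by decide) (by decide) (by decide) (by decide)
  have b1 := V.bracket_t_T_of_row (i := 2) (j := 1) (l := 0)
    (by decide) (by decide) (by decide) (by decide)
  have b2 : ⁅C (V.t 3 1 1), V.T 2 0⁆ₛ = _ • V.T 4 0 := V.bracket_t_T_of_row_rev
    (by decide) (by decide) (by decide) (by decide)
  have b3 := V.bracket_t_T_of_row (i := 3) (j := 1) (l := 0)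
    (by decide) (by decide) (by decide) (by decide)
  have b4 : ⁅C (V.t 2 1 1), V.T 3 0⁆ₛ = _ • V.T 4 0 := V.bracket_t_T_of_row_rev
    (by decide) (by decide) (by decide) (by decide)
  rw [e1, e2, e3, bracket_mul_right_right hh c21, bracket_mul_right_right hh c31,
    bracket_mul_right_right hh c31, bracket_mul_right_right hh c21, b1, b3, bracket_smul_right,
    bracket_smul_right, b2, b4]
  simp only [p1, p2, p3, t1, t2, t3, sub_self]

end DegreeThree

section DegreeFour

variable (V : OspSpace 7)

/-- The left bracket is a multiple of $t_{00}(u)^{-1}t_{02}(u)$ and the right one of $t_{13}^{(1)}$,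
which moves only the columns $1$ and $3'=3$ of the first row. -/
theorem degree_four_e : ⁅⁅V.e 1, C (V.e₁ 2)⁆ₛ, ⁅C (V.e₁ 2), C (V.e₁ 3)⁆ₛ⁆ₛ = 0 := by
  have h7 : ¬ Even 7 := by decide
  have e1 : V.e 1 = V.invDiag 0 * V.T 0 1 := by
    rw [← gaussE_zero]; simp [e, simplePos]
  have e2 : V.e₁ 2 = V.t 1 2 1 := by
    rw [← V.coeff_one_gaussE_T (by decide)]; simp [e₁, e, simplePos]
  have e3 : V.e₁ 3 = V.t 2 3 1 := by
    rw [← V.coeff_one_gaussE_T (by decide)]; simp [e₁, e, simplePos, h7]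
  have hh := V.parityAut_invDiag 0
  have c12 := V.commute_invDiag (i := 1) (j := 2) (p := 0)
    (by decide) (by decide) (by decide) (by decide) (by decide)
  have c13 := V.commute_invDiag (i := 1) (j := 3) (p := 0)
    (by decide) (by decide) (by decide) (by decide) (by decide)
  have b1 := V.bracket_t_t (V.bracket_t_T_of_row (i := 1) (j := 2) (l := 3)
    (by decide) (by decide) (by decide) (by decide)) 1
  have b2 := V.bracket_T_t (V.bracket_t_T_of_col (i := 1) (j := 2) (k := 0)
    (by decide) (by decide) (by decide) (by decide))
  have b3 := V.bracket_T_t_eq_zero (V.bracket_t_T_eq_zero (i := 1) (j := 3) (k := 0) (l := 2)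
    (by decide) (by decide) (by decide) (by decide) (by decide))
  rw [e1, e2, e3, bracket_C_C, b1, C_smul, bracket_smul_right, bracket_mul_left_left hh c12,
    bracket_mul_left_left hh c13, b2, bracket_smul_left, b3, smul_zero, mul_zero, smul_zero]

theorem degree_four_f : ⁅⁅V.f 1, C (V.f₁ 2)⁆ₛ, ⁅C (V.f₁ 2), C (V.f₁ 3)⁆ₛ⁆ₛ = 0 := by
  have h7 : ¬ Even 7 := by decide
  have e1 : V.f 1 = V.T 1 0 * V.invDiag 0 := by
    rw [← gaussF_zero]; simp [f, simplePos]
  have e2 : V.f₁ 2 = V.t 2 1 1 := by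
    rw [← V.coeff_one_gaussF_T (by decide)]; simp [f₁, f, simplePos]
  have e3 : V.f₁ 3 = V.t 3 2 1 := by
    rw [← V.coeff_one_gaussF_T (by decide)]; simp [f₁, f, simplePos, h7]
  have hh := V.parityAut_invDiag 0
  have c21 := V.commute_invDiag (i := 2) (j := 1) (p := 0)
    (by decide) (by decide) (by decide) (by decide) (by decide)
  have c31 := V.commute_invDiag (i := 3) (j := 1) (p := 0)
    (by decide) (by decide) (by decide) (by decide) (by decide)
  have b1 := V.bracket_t_t (V.bracket_t_T_of_col (i := 2) (j := 1) (k := 3)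
    (by decide) (by decide) (by decide) (by decide)) 1
  have b2 := V.bracket_T_t (V.bracket_t_T_of_row (i := 2) (j := 1) (l := 0)
    (by decide) (by decide) (by decide) (by decide))
  have b3 := V.bracket_T_t_eq_zero (V.bracket_t_T_eq_zero (i := 3) (j := 1) (k := 2) (l := 0)
    (by decide) (by decide) (by decide) (by decide) (by decide))
  rw [e1, e2, e3, bracket_C_C, b1, C_smul, bracket_smul_right, bracket_mul_right_left hh c21,
    bracket_mul_right_left hh c31, b2, bracket_smul_left, b3, smul_zero, zero_mul, smul_zero]

end DegreeFour

section DegreeSeven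

variable (V : OspSpace 8)

/-- The left bracket is a multiple of $t_{00}(u)^{-1}t_{03}(u)$ and the right one a combination of
$t_{26}^{(1)}$ and $t_{15}^{(1)}$. Both move only columns 1 and 2 of the first row, because $6'=1$
and $5'=2$. -/
theorem degree_seven_e {a : ZMod 2} (hV : V.paritySeq = ![a, 0, 0, 1]) :
    ⁅⁅V.e 1, ⁅C (V.e₁ 2), C (V.e₁ 3)⁆ₛ⁆ₛ,
      ⁅⁅C (V.e₁ 2), C (V.e₁ 3)⁆ₛ, ⁅C (V.e₁ 3), C (V.e₁ 4)⁆ₛ⁆ₛ⁆ₛ = 0 := by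
  have p3 : V.parity 3 = 1 := congrFun hV 3
  have e1 : V.e 1 = V.invDiag 0 * V.T 0 1 := by
    rw [← gaussE_zero]; simp [e, simplePos]
  have e2 : V.e₁ 2 = V.t 1 2 1 := by
    rw [← V.coeff_one_gaussE_T (by decide)]; simp [e₁, e, simplePos]
  have e3 : V.e₁ 3 = V.t 2 3 1 := by
    rw [← V.coeff_one_gaussE_T (by decide)]; simp [e₁, e, simplePos]
  have e4 : V.e₁ 4 = V.t 3 4 1 := by
    rw [← V.coeff_one_gaussE_T (by decide)]; simp [e₁, e, simplePos, p3]
  have hh := V.parityAut_invDiag 0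
  have c13 := V.commute_invDiag (i := 1) (j := 3) (p := 0)
    (by decide) (by decide) (by decide) (by decide) (by decide)
  have c26 := V.commute_invDiag (i := 2) (j := 6) (p := 0)
    (by decide) (by decide) (by decide) (by decide) (by decide)
  have c15 := V.commute_invDiag (i := 1) (j := 5) (p := 0)
    (by decide) (by decide) (by decide) (by decide) (by decide)
  have b1 := V.bracket_t_t (V.bracket_t_T_of_row (i := 1) (j := 2) (l := 3)
    (by decide) (by decide) (by decide) (by decide)) 1
  -- Since $4=3'$, both a $P$-term and a $Q$-term occur. Their coefficients can stay opaque: each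
  -- term leads to zero separately.
  obtain ⟨x, y, b2⟩ : ∃ x y : ℂ, ⁅V.t 2 3 1, V.t 3 4 1⁆ₛ = x • V.t 2 4 1 + y • V.t 3 5 1 := by
    refine ⟨superSign (V.parity 3), superSign (V.parity 3 * V.parity 3 + V.parity 3 * V.parity 2
      + V.parity 3) * V.theta 2 * V.theta 3, ?_⟩
    rw [V.bracket_t_one (by decide)]
    simp
  have b3 := V.bracket_T_t (V.bracket_t_T_of_col (i := 1) (j := 3) (k := 0)
    (by decide) (by decide) (by decide) (by decide))
  have b4 : ⁅V.t 1 3 1, V.t 2 4 1⁆ₛ = _ • V.t 2 6 1 := V.bracket_t_t (V.bracket_t_T_of_col_rev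
    (i := 1) (j := 3) (k := 2) (by decide) (by decide) (by decide) (by decide)) 1
  have b5 := V.bracket_t_t (V.bracket_t_T_of_row (i := 1) (j := 3) (l := 5)
    (by decide) (by decide) (by decide) (by decide)) 1
  have b6 := V.bracket_T_t_eq_zero (V.bracket_t_T_eq_zero (i := 2) (j := 6) (k := 0) (l := 3)
    (by decide) (by decide) (by decide) (by decide) (by decide))
  have b7 := V.bracket_T_t_eq_zero (V.bracket_t_T_eq_zero (i := 1) (j := 5) (k := 0) (l := 3)
    (by decide) (by decide) (by decide) (by decide) (by decide))
  simp only [e1, e2, e3, e4, bracket_C_C, b1, b2, bracket_smul_left, bracket_smul_right,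
    bracket_add_right, b4, b5, map_add, C_smul, bracket_mul_left_left hh c13, b3,
    mul_smul_comm, bracket_mul_left_left hh c26, bracket_mul_left_left hh c15, b6, b7, mul_zero,
    smul_zero, add_zero]

/-- The transposed argument: $t_{62}^{(1)}$ and $t_{51}^{(1)}$ move only rows 1 and 2 of the first
column and annihilate $t_{30}(u)$. -/
theorem degree_seven_f {a : ZMod 2} (hV : V.paritySeq = ![a, 0, 0, 1]) :
    ⁅⁅V.f 1, ⁅C (V.f₁ 2), C (V.f₁ 3)⁆ₛ⁆ₛ,
      ⁅⁅C (V.f₁ 2), C (V.f₁ 3)⁆ₛ, ⁅C (V.f₁ 3), C (V.f₁ 4)⁆ₛ⁆ₛ⁆ₛ = 0 := by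
  have p3 : V.parity 3 = 1 := congrFun hV 3
  have e1 : V.f 1 = V.T 1 0 * V.invDiag 0 := by
    rw [← gaussF_zero]; simp [f, simplePos]
  have e2 : V.f₁ 2 = V.t 2 1 1 := by
    rw [← V.coeff_one_gaussF_T (by decide)]; simp [f₁, f, simplePos]
  have e3 : V.f₁ 3 = V.t 3 2 1 := by
    rw [← V.coeff_one_gaussF_T (by decide)]; simp [f₁, f, simplePos]
  have e4 : V.f₁ 4 = V.t 4 3 1 := by
    rw [← V.coeff_one_gaussF_T (by decide)]; simp [f₁, f, simplePos, p3]
  have hh := V.parityAut_invDiag 0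
  have c31 := V.commute_invDiag (i := 3) (j := 1) (p := 0)
    (by decide) (by decide) (by decide) (by decide) (by decide)
  have c62 := V.commute_invDiag (i := 6) (j := 2) (p := 0)
    (by decide) (by decide) (by decide) (by decide) (by decide)
  have c51 := V.commute_invDiag (i := 5) (j := 1) (p := 0)
    (by decide) (by decide) (by decide) (by decide) (by decide)
  have b1 := V.bracket_t_t (V.bracket_t_T_of_col (i := 2) (j := 1) (k := 3)
    (by decide) (by decide) (by decide) (by decide)) 1
  obtain ⟨x, y, b2⟩ : ∃ x y : ℂ, ⁅V.t 3 2 1, V.t 4 3 1⁆ₛ = x • V.t 4 2 1 + y • V.t 5 3 1 := by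
    refine ⟨-superSign (V.parity 3 * V.parity 2 + V.parity 3 * V.parity 4
      + V.parity 2 * V.parity 4), -(superSign (V.parity 3 + V.parity 2
      + V.parity 3 * V.parity 2) * V.theta 3 * V.theta 2), ?_⟩
    rw [V.bracket_t_one (by decide)]
    simp only [Fin.reduceEq, Fin.reduceRev, if_true, if_false]
    module
  have b3 := V.bracket_T_t (V.bracket_t_T_of_row (i := 3) (j := 1) (l := 0)
    (by decide) (by decide) (by decide) (by decide))
  have b4 : ⁅V.t 3 1 1, V.t 4 2 1⁆ₛ = _ • V.t 6 2 1 := V.bracket_t_t (V.bracket_t_T_of_row_rev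
    (i := 3) (j := 1) (l := 2) (by decide) (by decide) (by decide) (by decide)) 1
  have b5 := V.bracket_t_t (V.bracket_t_T_of_col (i := 3) (j := 1) (k := 5)
    (by decide) (by decide) (by decide) (by decide)) 1
  have b6 := V.bracket_T_t_eq_zero (V.bracket_t_T_eq_zero (i := 6) (j := 2) (k := 3) (l := 0)
    (by decide) (by decide) (by decide) (by decide) (by decide))
  have b7 := V.bracket_T_t_eq_zero (V.bracket_t_T_eq_zero (i := 5) (j := 1) (k := 3) (l := 0)
    (by decide) (by decide) (by decide) (by decide) (by decide))
  simp only [e1, e2, e3, e4, bracket_C_C, b1, b2, bracket_smul_left, bracket_smul_right,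
    bracket_add_right, b4, b5, map_add, C_smul, bracket_mul_right_left hh c31, b3,
    smul_mul_assoc, bracket_mul_right_left hh c62, bracket_mul_right_left hh c51, b6, b7, zero_mul,
    smul_zero, add_zero]

end DegreeSeven

end OspSpace

end

/-! ### Assembly, and passage to the coefficients of $u^{-1}$ -/

theorem lemma4p9 :
    -- degree 3
    (∀ (V : OspSpace 6) (a : ZMod 2), V.paritySeq = ![a, 1, 0] →
      ⁅C (V.e₁ 3), ⁅C (V.e₁ 2), V.e 1⁆ₛ⁆ₛ - ⁅C (V.e₁ 2), ⁅C (V.e₁ 3), V.e 1⁆ₛ⁆ₛ = 0 ∧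
      ⁅C (V.f₁ 3), ⁅C (V.f₁ 2), V.f 1⁆ₛ⁆ₛ - ⁅C (V.f₁ 2), ⁅C (V.f₁ 3), V.f 1⁆ₛ⁆ₛ = 0 ∧
      ⁅V.e₁ 3, ⁅V.e₁ 2, V.e₁ 1⁆ₛ⁆ₛ - ⁅V.e₁ 2, ⁅V.e₁ 3, V.e₁ 1⁆ₛ⁆ₛ = 0 ∧
      ⁅V.f₁ 3, ⁅V.f₁ 2, V.f₁ 1⁆ₛ⁆ₛ - ⁅V.f₁ 2, ⁅V.f₁ 3, V.f₁ 1⁆ₛ⁆ₛ = 0) ∧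
    -- degree 4
    (∀ (V : OspSpace 7) (a b c : ZMod 2), V.paritySeq = ![a, b, c] → b ≠ c →
      ⁅⁅V.e 1, C (V.e₁ 2)⁆ₛ, ⁅C (V.e₁ 2), C (V.e₁ 3)⁆ₛ⁆ₛ = 0 ∧
      ⁅⁅V.f 1, C (V.f₁ 2)⁆ₛ, ⁅C (V.f₁ 2), C (V.f₁ 3)⁆ₛ⁆ₛ = 0 ∧
      ⁅⁅V.e₁ 1, V.e₁ 2⁆ₛ, ⁅V.e₁ 2, V.e₁ 3⁆ₛ⁆ₛ = 0 ∧
      ⁅⁅V.f₁ 1, V.f₁ 2⁆ₛ, ⁅V.f₁ 2, V.f₁ 3⁆ₛ⁆ₛ = 0) ∧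
    -- degree 7
    (∀ (V : OspSpace 8) (a : ZMod 2), V.paritySeq = ![a, 0, 0, 1] →
      ⁅⁅V.e 1, ⁅C (V.e₁ 2), C (V.e₁ 3)⁆ₛ⁆ₛ,
        ⁅⁅C (V.e₁ 2), C (V.e₁ 3)⁆ₛ, ⁅C (V.e₁ 3), C (V.e₁ 4)⁆ₛ⁆ₛ⁆ₛ = 0 ∧
      ⁅⁅V.f 1, ⁅C (V.f₁ 2), C (V.f₁ 3)⁆ₛ⁆ₛ,
        ⁅⁅C (V.f₁ 2), C (V.f₁ 3)⁆ₛ, ⁅C (V.f₁ 3), C (V.f₁ 4)⁆ₛ⁆ₛ⁆ₛ = 0 ∧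
      ⁅⁅V.e₁ 1, ⁅V.e₁ 2, V.e₁ 3⁆ₛ⁆ₛ, ⁅⁅V.e₁ 2, V.e₁ 3⁆ₛ, ⁅V.e₁ 3, V.e₁ 4⁆ₛ⁆ₛ⁆ₛ = 0 ∧
      ⁅⁅V.f₁ 1, ⁅V.f₁ 2, V.f₁ 3⁆ₛ⁆ₛ, ⁅⁅V.f₁ 2, V.f₁ 3⁆ₛ, ⁅V.f₁ 3, V.f₁ 4⁆ₛ⁆ₛ⁆ₛ = 0) := by
  refine ⟨fun V a hV => ?_, fun V a b c _ _ => ?_, fun V a hV => ?_⟩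
  · have he := V.degree_three_e hV
    have hf := V.degree_three_f hV
    refine ⟨he, hf, ?_, ?_⟩
    -- Only one entry of the nested bracket is non-constant, so taking the $u^{-1}$-coefficient
    -- replaces that current by its own coefficient.
    · simpa only [map_sub, Superalgebra.coeff_bracket_C_left,
        OspSpace.coeff_one_e, OspSpace.coeff_one_f, map_zero] using
        congrArg (PowerSeries.coeff 1) he
    · simpa only [map_sub, Superalgebra.coeff_bracket_C_left,
        OspSpace.coeff_one_e, OspSpace.coeff_one_f, map_zero] using
        congrArg (PowerSeries.coeff 1) hf
  · have he := V.degree_four_e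
    have hf := V.degree_four_f
    refine ⟨he, hf, ?_, ?_⟩
    · simpa only [Superalgebra.bracket_C_C, Superalgebra.coeff_bracket_C_right,
        OspSpace.coeff_one_e, OspSpace.coeff_one_f, map_zero] using
        congrArg (PowerSeries.coeff 1) he
    · simpa only [Superalgebra.bracket_C_C, Superalgebra.coeff_bracket_C_right,
        OspSpace.coeff_one_e, OspSpace.coeff_one_f, map_zero] using
        congrArg (PowerSeries.coeff 1) hf
  · have he := V.degree_seven_e hV
    have hf := V.degree_seven_f hV
    refine ⟨he, hf, ?_, ?_⟩
    · simpa only [Superalgebra.bracket_C_C, Superalgebra.coeff_bracket_C_right,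
        OspSpace.coeff_one_e, OspSpace.coeff_one_f, map_zero] using
        congrArg (PowerSeries.coeff 1) he
    · simpa only [Superalgebra.bracket_C_C, Superalgebra.coeff_bracket_C_right,
        OspSpace.coeff_one_e, OspSpace.coeff_one_f, map_zero] using
        congrArg (PowerSeries.coeff 1) hf
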